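/- Let $\rho$ be a probability measure on $\mathbb R^d$ with a density with respect to Lebesgue measure, and let $G:\mathbb R^d\times\mathbb R^d\to\mathbb R$ be measurable with $Z(y)=\int e^{-G(x,y)}\,dx<\infty$ for every $y$. Put $p_{X|Y=y}(x)=e^{-G(x,y)}/Z(y)$, let $P_{X|Y=y}$ be the probability measure with density $p_{X|Y=y}$, assume that $y\mapsto\log p_{X|Y=y}(x)$ is differentiable for every $x$, and let $\mu=\int P_{X|Y=y}\,d\rho(y)$ be the mixture. For a probability measure $\pi$ on $\mathbb R^d$ and $\gamma>0$: $\pi$ satisfies $\mathrm{PI}(\gamma)$ if $\mathbb E_\pi[f^2]-(\mathbb E_\pi f)^2\le\gamma\,\mathbb E_\pi\|\nabla f\|^2$ for all $f\in C_c^\infty(\mathbb R^d)$; it satisfies $\mathrm{LSI}(\gamma)$ if $\mathbb E_\pi[f^2\log f^2]-\mathbb E_\pi[f^2]\log\mathbb E_\pi[f^2]\le2\gamma\,\mathbb E_\pi\|\nabla f\|^2$ for all $f\in C_c^\infty(\mathbb R^d)$ (with $0\log 0=0$). For $\Phi:\mathcal S\to\mathbb R$ convex and twice differentiable on an open interval $\mathcal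 S$, $\pi$ satisfies $\Phi\text{-SI}(\gamma)$ if $\mathbb E_\pi[\Phi(f)]-\Phi(\mathbb E_\pi f)\le\frac\gamma2\,\mathbb E_\pi[\Phi''(f)\|\nabla f\|^2]$ for all smooth $f:\mathbb R^d\to\mathcal S$ that are constant outside a compact set. Let $\alpha,\beta,\bar L>0$ and $\xi=\beta+\alpha\beta\bar L^2$. Suppose that $\rho$ satisfies $\Phi\text{-SI}(\alpha)$ and that $P_{X|Y=y}$ satisfies $\Phi\text{-SI}(\beta)$ for every $y$. 1. If $\Phi(t)=t^2$, $\mathcal S=\mathbb R$, and for all $u,y\in\mathbb R^d$ $$\mathbb E_{x\sim P_{X|Y=y}}\big[\langle u,\nabla_y\log p_{X|Y=y}(x)\rangle^2\big]\le\bar L^2\|u\|^2,\tag{Var}$$ then $\mu$ satisfies $\mathrm{PI}(\xi)$. 2. If $\Phi(t)=t\log t$, $\mathcal S=(0,\infty)$, and for all $u,y\in\mathbb R^d$ $$\log\mathbb E_{x\sim P_{X|Y=y}}\big[\exp\langle u,\nabla_y\log p_{X|Y=y}(x)\rangle\big]\le\frac{\bar L^2\|u\|^2}{2},\tag{MGF}$$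 then $\mu$ satisfies $\mathrm{LSI}(\xi)$. Moreover, $\xi<\zeta$, where $\zeta=\inf_{C>0}\max\{\beta+\alpha(1+C^{-1})\bar L^2\beta,\ \alpha(1+C)\}$ is the constant of the corresponding inequality for the joint distribution $P_{X|Y=y}(dx)\,\rho(dy)$, hence for its marginal $\mu$. -/

import Mathlib

open MeasureTheory Real
open scoped ContDiff

noncomputable section

/-- The Euclidean space of dimension `d`. -/
abbrev Euc (d : ℕ) : Type := EuclideanSpace ℝ (Fin d)

/-! ### Functional inequalities -/

/-- The `Φ`-entropy `E_ν[Φ(f)] - Φ(E_ν[f])`. -/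
def phiEnt {d : ℕ} (ν : Measure (Euc d)) (Φ : ℝ → ℝ) (f : Euc d → ℝ) : ℝ :=
  (∫ x, Φ (f x) ∂ν) - Φ (∫ x, f x ∂ν)

/-- The entropy `E_ν[f log f] - E_ν[f] log E_ν[f]` of a nonnegative function, with `0 log 0 = 0`
(which is also the value that `Real.log` gives). -/
def ent {d : ℕ} (ν : Measure (Euc d)) (f : Euc d → ℝ) : ℝ :=
  (∫ x, f x * log (f x) ∂ν) - (∫ x, f x ∂ν) * log (∫ x, f x ∂ν)

/-- The Poincaré inequality with constant `γ`. -/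
def PI {d : ℕ} (γ : ℝ) (ν : Measure (Euc d)) : Prop :=
  ∀ f : Euc d → ℝ, ContDiff ℝ ∞ f → HasCompactSupport f →
    ProbabilityTheory.variance f ν ≤ γ * ∫ x, ‖gradient f x‖ ^ 2 ∂ν

/-- The log-Sobolev inequality with constant `γ`. -/
def LSI {d : ℕ} (γ : ℝ) (ν : Measure (Euc d)) : Prop :=
  ∀ f : Euc d → ℝ, ContDiff ℝ ∞ f → HasCompactSupport f →
    ent ν (fun x => f x ^ 2) ≤ 2 * γ * ∫ x, ‖gradient f x‖ ^ 2 ∂ν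

/-- The `Φ`-Sobolev inequality with constant `γ`, for `Φ` on an open interval `S`.
The test functions are the `S`-valued smooth functions which are constant outside a compact set.
Compact support itself would leave no test function at all for `S = (0, ∞)` in dimension `d ≥ 1`.
With `S = ℝ`, `Φ(t) = t²` this is the Poincaré inequality (the variance does not see additive
constants), and with `S = (0, ∞)`, `Φ(t) = t log t` it is the log-Sobolev inequality (`f = h²`). -/
def PhiSI {d : ℕ} (S : Set ℝ) (Φ : ℝ → ℝ) (γ : ℝ) (ν : Measure (Euc d)) : Prop :=
  ∀ f : Euc d → ℝ, ContDiff ℝ ∞ f → (∃ c : ℝ, HasCompactSupport (fun x => f x - c)) →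
    (∀ x, f x ∈ S) →
    phiEnt ν Φ f ≤ γ / 2 * ∫ x, deriv (deriv Φ) (f x) * ‖gradient f x‖ ^ 2 ∂ν

/-! ### The conditional distributions and the mixture -/

/-- The normalisation constant `Z(y) = ∫ exp(-G(x, y)) dx`. -/
def normConst {d : ℕ} (G : Euc d → Euc d → ℝ) (y : Euc d) : ℝ :=
  ∫ x, exp (-G x y)

/-- The conditional density `p_{X|Y=y}(x) = exp(-G(x, y)) / Z(y)`. -/
def condDensity {d : ℕ} (G : Euc d → Euc d → ℝ) (y x : Euc d) : ℝ :=
  exp (-G x y) / normConst G y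

/-- The conditional distribution `P_{X|Y=y}`. -/
def condDist {d : ℕ} (G : Euc d → Euc d → ℝ) (y : Euc d) : Measure (Euc d) :=
  volume.withDensity (fun x => ENNReal.ofReal (condDensity G y x))

/-- The mixture `μ = ∫ P_{X|Y=y} dρ(y)`. -/
def mixture {d : ℕ} (ρ : Measure (Euc d)) (G : Euc d → Euc d → ℝ) : Measure (Euc d) :=
  ρ.bind (condDist G)

/-- The score `∇_y log p_{X|Y=y}(x)`. -/
def score {d : ℕ} (G : Euc d → Euc d → ℝ) (y x : Euc d) : Euc d :=
  gradient (fun y' => log (condDensity G y' x)) y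

/-! ### The two-scale criteria -/

/-- The variance criterion with constant `L`; the expectation is required to be finite. -/
def VarCriterion {d : ℕ} (G : Euc d → Euc d → ℝ) (L : ℝ) : Prop :=
  ∀ u y : Euc d,
    Integrable (fun x => inner ℝ u (score G y x) ^ 2) (condDist G y) ∧
      ∫ x, inner ℝ u (score G y x) ^ 2 ∂(condDist G y) ≤ L ^ 2 * ‖u‖ ^ 2

/-- The moment generating function criterion with constant `L`; the expectation is required to be
finite. -/
def MGFCriterion {d : ℕ} (G : Euc d → Euc d → ℝ) (L : ℝ) : Prop :=
  ∀ u y : Euc d,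
    Integrable (fun x => exp (inner ℝ u (score G y x))) (condDist G y) ∧
      log (∫ x, exp (inner ℝ u (score G y x)) ∂(condDist G y)) ≤ L ^ 2 * ‖u‖ ^ 2 / 2

/-- The constant `ζ = inf_{C > 0} max{β + α(1 + 1/C)L²β, α(1 + C)}` which holds for the joint
distribution of `(X, Y)`, hence for its marginal, the mixture. -/
def jointConst (α β L : ℝ) : ℝ :=
  ⨅ C : Set.Ioi (0 : ℝ),
    max (β + α * (1 + (C : ℝ)⁻¹) * L ^ 2 * β) (α * (1 + (C : ℝ)))

end

noncomputable section TwoScaleProof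

open Filter Topology
open scoped NNReal Convolution

/-! Write `F y` for the mean of a test function `h` under `condDist G y`. The `Φ`-entropy of `h`
under the mixture splits into the `ρ`-average of the conditional entropies of `h`, which the
conditional inequality bounds, and the entropy of `F` under `ρ`, which the inequality for `ρ` bounds
by `α / 2` times the integral of `Φ''(F) ‖∇F‖²`. It remains to prove `Φ''(F) ‖∇F‖² ≤ β L² E[Φ''(h)
‖∇h‖²]`, the expectation being conditional on `y` (`phiEnt_mixture_le`).

Formally `⟨u, ∇F⟩ = E[h ⟨u, score⟩]`. For `t²` the score is centred, so this is a covariance, and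
Cauchy–Schwarz gives `‖∇F‖² ≤ L² Var(h)`. For `t log t` the Donsker–Varadhan inequality, optimised
over multiples of `u`, gives `‖∇F‖² ≤ 2 L² F Ent(h)`. The conditional inequality applied once more
to `Var(h)` or `Ent(h)` produces the factor `β`.

Two analytic points remain. First, `F` is neither smooth nor constant outside a compact set, only
bounded and Lipschitz; mollification and cutoff extend the inequality for `ρ` to such functions
(`PhiSI.of_lipschitz`), absolute continuity making Lebesgue-null sets harmless. Second, the
log-density is only differentiable pointwise in `y`, with no dominating function. A first-moment
bound on the score, uniform in `y`, allows Fubini and the fundamental theorem of calculus along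
lines, which yields the formula for `∇F` almost everywhere (`ae_fderiv_integral_condDist`). -/

/-! ### Gradients and stability of `Φ`-Sobolev inequalities under limits -/

theorem norm_gradient_eq_norm_fderiv {d : ℕ} (f : Euc d → ℝ) (x : Euc d) :
    ‖gradient f x‖ = ‖fderiv ℝ f x‖ :=
  LinearIsometryEquiv.norm_map _ _

theorem measurable_norm_gradient_sq {d : ℕ} (f : Euc d → ℝ) :
    Measurable fun x => ‖gradient f x‖ ^ 2 := by
  simp_rw [norm_gradient_eq_norm_fderiv]
  exact (measurable_fderiv ℝ f).norm.pow_const 2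

theorem continuous_comp_of_mem_Icc {X : Type*} [TopologicalSpace X] {Φ : ℝ → ℝ} {m M : ℝ}
    (hΦ : ContinuousOn Φ (Set.Icc m M)) {F : X → ℝ} (hF : Continuous F)
    (hm : ∀ x, F x ∈ Set.Icc m M) : Continuous fun x => Φ (F x) :=
  hΦ.comp_continuous hF hm

/-- The `Φ`-Sobolev inequality for a single function passes to limits of uniformly bounded,
uniformly Lipschitz functions whose derivatives converge almost everywhere. -/
theorem phiEnt_le_of_tendsto {d : ℕ} {ρ : Measure (Euc d)} [IsProbabilityMeasure ρ]
    {Φ : ℝ → ℝ} {γ m M : ℝ} {K : ℝ≥0}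
    (hΦ : ContinuousOn Φ (Set.Icc m M))
    (hΦ2 : ContinuousOn (deriv (deriv Φ)) (Set.Icc m M))
    {F : Euc d → ℝ} {Fn : ℕ → Euc d → ℝ}
    (hFm : ∀ x, F x ∈ Set.Icc m M)
    (hFnm : ∀ n x, Fn n x ∈ Set.Icc m M) (hFnK : ∀ n, LipschitzWith K (Fn n))
    (hlim : ∀ᵐ x ∂ρ, Tendsto (fun n => Fn n x) atTop (𝓝 (F x)))
    (hlim' : ∀ᵐ x ∂ρ, Tendsto (fun n => fderiv ℝ (Fn n) x) atTop (𝓝 (fderiv ℝ F x)))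
    (h : ∀ n, phiEnt ρ Φ (Fn n) ≤
      γ / 2 * ∫ x, deriv (deriv Φ) (Fn n x) * ‖gradient (Fn n) x‖ ^ 2 ∂ρ) :
    phiEnt ρ Φ F ≤ γ / 2 * ∫ x, deriv (deriv Φ) (F x) * ‖gradient F x‖ ^ 2 ∂ρ := by
  obtain ⟨B, hB⟩ := isCompact_Icc.exists_bound_of_continuousOn hΦ
  obtain ⟨B2, hB2⟩ := isCompact_Icc.exists_bound_of_continuousOn hΦ2
  have hcomp : ∀ {Ψ : ℝ → ℝ}, ContinuousOn Ψ (Set.Icc m M) →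
      ∀ᵐ x ∂ρ, Tendsto (fun n => Ψ (Fn n x)) atTop (𝓝 (Ψ (F x))) := by
    intro Ψ hΨ
    filter_upwards [hlim] with x hx
    exact (hΨ (F x) (hFm x)).tendsto.comp
      (tendsto_nhdsWithin_iff.2 ⟨hx, Eventually.of_forall fun n => hFnm n x⟩)
  have h1 : Tendsto (fun n => ∫ x, Φ (Fn n x) ∂ρ) atTop (𝓝 (∫ x, Φ (F x) ∂ρ)) := by
    refine tendsto_integral_of_dominated_convergence (fun _ => B) (fun n => ?_)
      (integrable_const _) (fun n => Eventually.of_forall fun x => hB _ (hFnm n x)) (hcomp hΦ)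
    exact (continuous_comp_of_mem_Icc hΦ (hFnK n).continuous (hFnm n)).aestronglyMeasurable
  have h2 : Tendsto (fun n => ∫ x, Fn n x ∂ρ) atTop (𝓝 (∫ x, F x ∂ρ)) := by
    refine tendsto_integral_of_dominated_convergence (fun _ => max |m| |M|) (fun n => ?_)
      (integrable_const _)
      (fun n => Eventually.of_forall fun x => abs_le_max_abs_abs (hFnm n x).1 (hFnm n x).2) hlim
    exact (hFnK n).continuous.aestronglyMeasurable
  -- The means stay in `[m, M]`, the only place where `Φ` is known to be continuous.
  have hmem : ∀ n, ∫ x, Fn n x ∂ρ ∈ Set.Icc m M := fun n =>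
    (convex_Icc m M).integral_mem isClosed_Icc (Eventually.of_forall (hFnm n))
      (Integrable.of_mem_Icc m M (hFnK n).continuous.aemeasurable
        (Eventually.of_forall (hFnm n)))
  have hmem' : ∫ x, F x ∂ρ ∈ Set.Icc m M :=
    isClosed_Icc.mem_of_tendsto h2 (Eventually.of_forall hmem)
  have h3 : Tendsto (fun n => Φ (∫ x, Fn n x ∂ρ)) atTop (𝓝 (Φ (∫ x, F x ∂ρ))) :=
    (hΦ _ hmem').tendsto.comp (tendsto_nhdsWithin_iff.2 ⟨h2, Eventually.of_forall hmem⟩)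
  have h4 : Tendsto (fun n => ∫ x, deriv (deriv Φ) (Fn n x) * ‖gradient (Fn n) x‖ ^ 2 ∂ρ) atTop
      (𝓝 (∫ x, deriv (deriv Φ) (F x) * ‖gradient F x‖ ^ 2 ∂ρ)) := by
    refine tendsto_integral_of_dominated_convergence (fun _ => B2 * (K : ℝ) ^ 2) (fun n => ?_)
      (integrable_const _) (fun n => Eventually.of_forall fun x => ?_) ?_
    · exact (continuous_comp_of_mem_Icc hΦ2 (hFnK n).continuous (hFnm n)).aestronglyMeasurable.mul
        (measurable_norm_gradient_sq _).aestronglyMeasurable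
    · rw [norm_mul, norm_pow, norm_norm, norm_gradient_eq_norm_fderiv]
      gcongr
      · exact (norm_nonneg _).trans (hB2 _ (hFnm n x))
      · exact hB2 _ (hFnm n x)
      · exact norm_fderiv_le_of_lipschitz ℝ (hFnK n)
    · filter_upwards [hcomp hΦ2, hlim'] with x hx hx'
      simp_rw [norm_gradient_eq_norm_fderiv]
      exact hx.mul (hx'.norm.pow 2)
  exact le_of_tendsto_of_tendsto' (h1.sub h3) (h4.const_mul _) h

/-! ### Mollification -/

section Mollification

variable {d : ℕ} (φ : ContDiffBump (0 : Euc d)) {ψ : Euc d → ℝ}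

theorem normed_convolution_apply (g : Euc d → ℝ) (x : Euc d) :
    (φ.normed volume ⋆[ContinuousLinearMap.lsmul ℝ ℝ, volume] g) x =
      ∫ t, φ.normed volume t * g (x - t) := rfl

theorem integrable_normed_mul_comp_sub (hψ : Continuous ψ) (x : Euc d) :
    Integrable (fun t => φ.normed volume t * ψ (x - t)) := by
  refine Continuous.integrable_of_hasCompactSupport ?_ ?_
  · exact φ.continuous_normed.mul (hψ.comp (continuous_const.sub continuous_id))
  · exact (φ.hasCompactSupport_normed).mul_right

/-- The mollifier is a probability density, so convolution averages translates of `ψ`; pointwise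
bounds and the Lipschitz constant survive unchanged. -/
theorem normed_convolution_mem_Icc (hψ : Continuous ψ) {a b : ℝ}
    (hab : ∀ x, ψ x ∈ Set.Icc a b) (x : Euc d) :
    (φ.normed volume ⋆[ContinuousLinearMap.lsmul ℝ ℝ, volume] ψ) x ∈ Set.Icc a b := by
  rw [normed_convolution_apply]
  have hint : Integrable (φ.normed volume) (volume : Measure (Euc d)) := φ.integrable_normed
  constructor
  · calc a = ∫ t, φ.normed volume t * a := by
          rw [integral_mul_const, φ.integral_normed, one_mul]
      _ ≤ _ := integral_mono (hint.mul_const _) (integrable_normed_mul_comp_sub φ hψ x)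
          fun t => mul_le_mul_of_nonneg_left (hab _).1 (φ.nonneg_normed t)
  · calc _ ≤ ∫ t, φ.normed volume t * b :=
          integral_mono (integrable_normed_mul_comp_sub φ hψ x) (hint.mul_const _)
          fun t => mul_le_mul_of_nonneg_left (hab _).2 (φ.nonneg_normed t)
      _ = b := by rw [integral_mul_const, φ.integral_normed, one_mul]

theorem lipschitzWith_normed_convolution {K : ℝ≥0} (hψ : LipschitzWith K ψ) :
    LipschitzWith K (φ.normed volume ⋆[ContinuousLinearMap.lsmul ℝ ℝ, volume] ψ) := by
  refine LipschitzWith.of_dist_le_mul fun x y => ?_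
  rw [normed_convolution_apply, normed_convolution_apply, dist_eq_norm,
    ← integral_sub (integrable_normed_mul_comp_sub φ hψ.continuous x)
      (integrable_normed_mul_comp_sub φ hψ.continuous y)]
  calc _ ≤ ∫ t, φ.normed volume t * (K * dist x y) := by
        refine norm_integral_le_of_norm_le (φ.integrable_normed.mul_const _)
          (Eventually.of_forall fun t => ?_)
        rw [← mul_sub, norm_mul, Real.norm_of_nonneg (φ.nonneg_normed t)]
        refine mul_le_mul_of_nonneg_left ?_ (φ.nonneg_normed t)
        have := hψ.dist_le_mul (x - t) (y - t)
        rwa [dist_sub_right, dist_eq_norm (ψ _)] at this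
    _ = K * dist x y := by rw [integral_mul_const, φ.integral_normed, one_mul]

/-- By Rademacher's theorem `ψ (x - t)` is differentiable in `x` for almost every `t`, and the
Lipschitz constant times the mollifier dominates the difference quotients. -/
theorem fderiv_normed_convolution {K : ℝ≥0} (hψ : LipschitzWith K ψ) (x : Euc d) :
    fderiv ℝ (φ.normed volume ⋆[ContinuousLinearMap.lsmul ℝ ℝ, volume] ψ) x =
      (φ.normed volume ⋆[ContinuousLinearMap.lsmul ℝ ℝ, volume] (fderiv ℝ ψ)) x := by
  have hae : ∀ᵐ t : Euc d, DifferentiableAt ℝ ψ (x - t) :=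
    (Measure.measurePreserving_sub_left volume x).quasiMeasurePreserving.ae
      hψ.ae_differentiableAt
  refine (hasFDerivAt_integral_of_dominated_loc_of_lip
    (F' := fun t => φ.normed volume t • fderiv ℝ ψ (x - t))
    (bound := fun t => K * φ.normed volume t)
    univ_mem (Eventually.of_forall fun y =>
      (integrable_normed_mul_comp_sub φ hψ.continuous y).aestronglyMeasurable)
    (integrable_normed_mul_comp_sub φ hψ.continuous x) ?_ ?_
    (φ.integrable_normed.const_mul _) ?_).2.fderiv
  · refine (φ.continuous_normed.measurable.smul ?_).aestronglyMeasurable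
    exact (measurable_fderiv ℝ ψ).comp (measurable_const.sub measurable_id)
  · refine Eventually.of_forall fun t => LipschitzWith.lipschitzOnWith ?_
    refine LipschitzWith.of_dist_le_mul fun y z => ?_
    have := hψ.dist_le_mul (y - t) (z - t)
    rw [dist_sub_right] at this
    rw [dist_eq_norm, ← mul_sub, norm_mul, Real.norm_of_nonneg (φ.nonneg_normed t), ← dist_eq_norm,
      Real.coe_nnabs, abs_of_nonneg (mul_nonneg K.coe_nonneg (φ.nonneg_normed t))]
    calc _ ≤ φ.normed volume t * (K * dist y z) :=
          mul_le_mul_of_nonneg_left this (φ.nonneg_normed t)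
      _ = _ := by ring
  · filter_upwards [hae] with t ht
    have h1 : HasFDerivAt (fun y : Euc d => y - t) (ContinuousLinearMap.id ℝ (Euc d)) x :=
      (hasFDerivAt_id x).sub_const t
    exact (ht.hasFDerivAt.comp x h1).const_smul (φ.normed volume t)

end Mollification

/-- A sequence of bump functions shrinking to the origin. -/
def shrinkingBump (d : ℕ) (n : ℕ) : ContDiffBump (0 : Euc d) where
  rIn := 1 / ((n : ℝ) + 1)
  rOut := 2 * (1 / ((n : ℝ) + 1))
  rIn_pos := by positivity
  rIn_lt_rOut := by
    have : 0 < 1 / ((n : ℝ) + 1) := by positivity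
    linarith

theorem tendsto_rOut_shrinkingBump (d : ℕ) :
    Tendsto (fun n => (shrinkingBump d n).rOut) atTop (𝓝 0) := by
  simpa [shrinkingBump] using (tendsto_one_div_add_atTop_nhds_zero_nat (𝕜 := ℝ)).const_mul 2

/-- The `Φ`-Sobolev inequality extends to Lipschitz functions constant outside a compact set. -/
theorem PhiSI.of_lipschitz_of_hasCompactSupport {d : ℕ} {ρ : Measure (Euc d)}
    [IsProbabilityMeasure ρ] (hρ : ρ ≪ volume) {S : Set ℝ} {Φ : ℝ → ℝ} {γ m M c : ℝ} {K : ℝ≥0}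
    (h : PhiSI S Φ γ ρ) (hS : Set.Icc m M ⊆ S)
    (hΦ : ContinuousOn Φ (Set.Icc m M))
    (hΦ2 : ContinuousOn (deriv (deriv Φ)) (Set.Icc m M))
    {F : Euc d → ℝ} (hFm : ∀ x, F x ∈ Set.Icc m M) (hFK : LipschitzWith K F)
    (hc : HasCompactSupport fun x => F x - c) :
    phiEnt ρ Φ F ≤ γ / 2 * ∫ x, deriv (deriv Φ) (F x) * ‖gradient F x‖ ^ 2 ∂ρ := by
  -- Removing the constant `c` makes the support compact, which convolution preserves; `c` is added
  -- back afterwards.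
  set ψ : Euc d → ℝ := fun x => F x - c with hψdef
  have hψK : LipschitzWith K ψ := LipschitzWith.of_dist_le_mul fun x y => by
    simpa [hψdef, dist_sub_right] using hFK.dist_le_mul x y
  have hψm : ∀ x, ψ x ∈ Set.Icc (m - c) (M - c) := fun x =>
    ⟨sub_le_sub_right (hFm x).1 c, sub_le_sub_right (hFm x).2 c⟩
  let ψn : ℕ → Euc d → ℝ := fun n =>
    (shrinkingBump d n).normed volume ⋆[ContinuousLinearMap.lsmul ℝ ℝ, volume] ψ
  have hψnm : ∀ n x, ψn n x + c ∈ Set.Icc m M := fun n x => by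
    have := normed_convolution_mem_Icc (shrinkingBump d n) hψK.continuous hψm x
    exact ⟨by linarith [this.1], by linarith [this.2]⟩
  have hψnK : ∀ n, LipschitzWith K (ψn n) := fun n =>
    lipschitzWith_normed_convolution _ hψK
  have hfd : fderiv ℝ F = fderiv ℝ ψ := by
    ext1 x
    exact (fderiv_sub_const c).symm
  refine phiEnt_le_of_tendsto (K := K) (Fn := fun n x => ψn n x + c) hΦ hΦ2 hFm hψnm
    (fun n => LipschitzWith.of_dist_le_mul fun x y => ?_) (Eventually.of_forall fun x => ?_) ?_
    fun n => h _ ?_ ⟨c, ?_⟩ fun x => hS (hψnm n x)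
  · simpa [dist_add_right] using (hψnK n).dist_le_mul x y
  · have := (ContDiffBump.convolution_tendsto_right_of_continuous (μ := volume)
      (tendsto_rOut_shrinkingBump d) hψK.continuous x).add_const c
    simpa [hψdef] using this
  · have hloc : LocallyIntegrable (fderiv ℝ ψ) (volume : Measure (Euc d)) := by
      refine MemLp.locallyIntegrable (p := ⊤) ?_ le_top
      exact memLp_top_of_bound (measurable_fderiv ℝ ψ).aestronglyMeasurable K
        (Eventually.of_forall fun x => norm_fderiv_le_of_lipschitz ℝ hψK)
    -- The derivative is merely bounded and measurable, so its mollifications converge only at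
    -- Lebesgue points; `2` is the fixed ratio of outer to inner radius of the bumps.
    have := ContDiffBump.ae_convolution_tendsto_right_of_locallyIntegrable
      (φ := shrinkingBump d) (K := 2) (tendsto_rOut_shrinkingBump d)
      (Eventually.of_forall fun n => le_refl _) hloc
    filter_upwards [hρ.ae_le this] with x hx
    rw [hfd]
    refine hx.congr fun n => ?_
    rw [fderiv_add_const, fderiv_normed_convolution _ hψK]
  · refine ContDiff.add ?_ contDiff_const
    exact HasCompactSupport.contDiff_convolution_left _ (ContDiffBump.hasCompactSupport_normed _)
      (ContDiffBump.contDiff_normed _) hψK.continuous.locallyIntegrable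
  · simpa using (HasCompactSupport.convolution (ContinuousLinearMap.lsmul ℝ ℝ)
      ((shrinkingBump d n).hasCompactSupport_normed (μ := volume)) hc)

/-! ### Cutoff -/

/-- A `1`-Lipschitz cutoff function: `1` on the ball of radius `n`, `0` outside that of radius
`n + 1`. -/
def lipCutoff {d : ℕ} (n : ℕ) (x : Euc d) : ℝ := max 0 (min 1 (n + 1 - ‖x‖))

theorem lipCutoff_mem_Icc {d : ℕ} (n : ℕ) (x : Euc d) : lipCutoff n x ∈ Set.Icc (0 : ℝ) 1 :=
  ⟨le_max_left _ _, max_le zero_le_one (min_le_left _ _)⟩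

theorem abs_lipCutoff_sub_le {d : ℕ} (n : ℕ) (x y : Euc d) :
    |lipCutoff n x - lipCutoff n y| ≤ dist x y := by
  have h1 := abs_max_sub_max_le_max (0 : ℝ) (min 1 (n + 1 - ‖x‖)) 0 (min 1 (n + 1 - ‖y‖))
  have h2 := abs_min_sub_min_le_max (1 : ℝ) (n + 1 - ‖x‖) 1 (n + 1 - ‖y‖)
  have h3 : |(n + 1 - ‖x‖) - (n + 1 - ‖y‖)| ≤ dist x y := by
    rw [dist_eq_norm, sub_sub_sub_cancel_left, abs_sub_comm]
    exact abs_norm_sub_norm_le x y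
  simp only [sub_self, abs_zero] at h1 h2
  refine h1.trans (max_le dist_nonneg (h2.trans (max_le dist_nonneg h3)))

theorem lipCutoff_eq_one {d : ℕ} {n : ℕ} {x : Euc d} (h : ‖x‖ ≤ n) : lipCutoff n x = 1 := by
  rw [lipCutoff, min_eq_left (by linarith), max_eq_right zero_le_one]

theorem lipCutoff_eq_zero {d : ℕ} {n : ℕ} {x : Euc d} (h : n + 1 ≤ ‖x‖) : lipCutoff n x = 0 := by
  rw [lipCutoff, max_eq_left ((min_le_right _ _).trans (by linarith))]

/-- The `Φ`-Sobolev inequality extends to bounded Lipschitz functions. -/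
theorem PhiSI.of_lipschitz {d : ℕ} {ρ : Measure (Euc d)}
    [IsProbabilityMeasure ρ] (hρ : ρ ≪ volume) {S : Set ℝ} {Φ : ℝ → ℝ} {γ m M : ℝ} {K : ℝ≥0}
    (h : PhiSI S Φ γ ρ) (hS : Set.Icc m M ⊆ S)
    (hΦ : ContinuousOn Φ (Set.Icc m M))
    (hΦ2 : ContinuousOn (deriv (deriv Φ)) (Set.Icc m M))
    {F : Euc d → ℝ} (hFm : ∀ x, F x ∈ Set.Icc m M) (hFK : LipschitzWith K F) :
    phiEnt ρ Φ F ≤ γ / 2 * ∫ x, deriv (deriv Φ) (F x) * ‖gradient F x‖ ^ 2 ∂ρ := by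
  -- Cutting off towards `m` instead of `0` keeps the values in `[m, M]`, hence in `S`.
  let Fn : ℕ → Euc d → ℝ := fun n x => m + lipCutoff n x * (F x - m)
  have hmM : m ≤ M := (hFm 0).1.trans (hFm 0).2
  have hFnm : ∀ n x, Fn n x ∈ Set.Icc m M := by
    intro n x
    have h1 := lipCutoff_mem_Icc n x
    have h2 := hFm x
    refine ⟨le_add_of_nonneg_right (mul_nonneg h1.1 (sub_nonneg.2 h2.1)), ?_⟩
    have : lipCutoff n x * (F x - m) ≤ 1 * (F x - m) :=
      mul_le_mul_of_nonneg_right h1.2 (sub_nonneg.2 h2.1)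
    simp only [Fn]
    linarith [h2.2]
  have hFnK : ∀ n, LipschitzWith (K + (M - m).toNNReal) (Fn n) := by
    refine fun n => LipschitzWith.of_dist_le_mul fun x y => ?_
    have h1 := lipCutoff_mem_Icc n x
    have h2 := abs_lipCutoff_sub_le n x y
    have h3 := hFK.dist_le_mul x y
    rw [Real.dist_eq] at h3
    rw [Real.dist_eq, NNReal.coe_add, Real.coe_toNNReal _ (sub_nonneg.2 hmM)]
    have h4 : Fn n x - Fn n y = lipCutoff n x * (F x - F y) +
        (lipCutoff n x - lipCutoff n y) * (F y - m) := by simp only [Fn]; ring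
    rw [h4]
    refine (abs_add_le _ _).trans ?_
    rw [abs_mul, abs_mul, add_mul, abs_of_nonneg h1.1, abs_of_nonneg (sub_nonneg.2 (hFm y).1)]
    refine add_le_add ?_ ?_
    · calc _ ≤ 1 * |F x - F y| := mul_le_mul_of_nonneg_right h1.2 (abs_nonneg _)
        _ ≤ _ := by rwa [one_mul]
    · rw [mul_comm]
      exact mul_le_mul (sub_le_sub_right (hFm y).2 m) h2 (abs_nonneg _) (sub_nonneg.2 hmM)
  have hev : ∀ x, ∀ᶠ n in atTop, Fn n =ᶠ[𝓝 x] F := by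
    intro x
    obtain ⟨N, hN⟩ := exists_nat_gt ‖x‖
    filter_upwards [eventually_ge_atTop N] with n hn
    have : ∀ᶠ y in 𝓝 x, ‖y‖ < N := continuous_norm.continuousAt.eventually_lt_const hN
    filter_upwards [this] with y hy
    simp only [Fn]
    rw [lipCutoff_eq_one (hy.le.trans (by exact_mod_cast hn))]
    ring
  refine phiEnt_le_of_tendsto (Fn := Fn) hΦ hΦ2 hFm hFnm hFnK
    (Eventually.of_forall fun x => ?_) (Eventually.of_forall fun x => ?_) fun n =>
      h.of_lipschitz_of_hasCompactSupport hρ hS hΦ hΦ2 (hFnm n) (hFnK n) (c := m) ?_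
  · exact tendsto_const_nhds.congr' ((hev x).mono fun n hn => hn.eq_of_nhds.symm)
  · exact tendsto_const_nhds.congr' ((hev x).mono fun n hn => hn.fderiv_eq.symm)
  · refine HasCompactSupport.intro (isCompact_closedBall (0 : Euc d) (n + 1)) fun x hx => ?_
    rw [mem_closedBall_zero_iff, not_le] at hx
    simp only [Fn]
    rw [lipCutoff_eq_zero hx.le]
    ring

/-! ### The conditional distributions -/

section Conditional

variable {d : ℕ} {G : Euc d → Euc d → ℝ}

theorem normConst_pos (hZ : ∀ y, Integrable (fun x => exp (-G x y)) volume) (y : Euc d) :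
    0 < normConst G y :=
  integral_exp_pos (hZ y)

theorem condDensity_pos (hZ : ∀ y, Integrable (fun x => exp (-G x y)) volume) (y x : Euc d) :
    0 < condDensity G y x :=
  div_pos (exp_pos _) (normConst_pos hZ y)

theorem measurable_condDensity (hG : Measurable (Function.uncurry G)) :
    Measurable (Function.uncurry (condDensity G)) := by
  have h1 : Measurable fun z : Euc d × Euc d => exp (-G z.2 z.1) :=
    ((hG.comp measurable_swap).neg).exp
  have h2 : Measurable (normConst G) :=
    (StronglyMeasurable.integral_prod_right (ν := volume)
      (f := fun y x => exp (-G x y)) h1.stronglyMeasurable).measurable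
  exact h1.div (h2.comp measurable_fst)

theorem measurable_condDensity_right (hG : Measurable (Function.uncurry G)) (y : Euc d) :
    Measurable (condDensity G y) :=
  (measurable_condDensity hG).comp measurable_prodMk_left

theorem integrable_condDensity (hZ : ∀ y, Integrable (fun x => exp (-G x y)) volume)
    (y : Euc d) : Integrable (condDensity G y) :=
  (hZ y).div_const _

theorem integral_condDensity (hZ : ∀ y, Integrable (fun x => exp (-G x y)) volume)
    (y : Euc d) : ∫ x, condDensity G y x = 1 := by
  simp_rw [condDensity]
  rw [integral_div]
  exact div_self (normConst_pos hZ y).ne'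

theorem isProbabilityMeasure_condDist
    (hZ : ∀ y, Integrable (fun x => exp (-G x y)) volume) (y : Euc d) :
    IsProbabilityMeasure (condDist G y) := by
  constructor
  rw [condDist, withDensity_apply _ MeasurableSet.univ, Measure.restrict_univ,
    ← ofReal_integral_eq_lintegral_ofReal (integrable_condDensity hZ y)
      (Eventually.of_forall fun x => (condDensity_pos hZ y x).le),
    integral_condDensity hZ y, ENNReal.ofReal_one]

theorem measurable_condDist (hG : Measurable (Function.uncurry G)) :
    Measurable (condDist G) := by
  refine Measure.measurable_of_measurable_coe _ fun s hs => ?_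
  simp_rw [condDist, withDensity_apply _ hs]
  exact Measurable.lintegral_prod_right' (measurable_condDensity hG).ennreal_ofReal

theorem integral_condDist (hG : Measurable (Function.uncurry G))
    (hZ : ∀ y, Integrable (fun x => exp (-G x y)) volume) (y : Euc d) (g : Euc d → ℝ) :
    ∫ x, g x ∂(condDist G y) = ∫ x, condDensity G y x * g x := by
  rw [condDist, integral_withDensity_eq_integral_toReal_smul
    (measurable_condDensity_right hG y).ennreal_ofReal
    (Eventually.of_forall fun x => ENNReal.ofReal_lt_top)]
  simp_rw [ENNReal.toReal_ofReal (condDensity_pos hZ y _).le, smul_eq_mul]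

theorem integrable_condDist_iff (hG : Measurable (Function.uncurry G))
    (hZ : ∀ y, Integrable (fun x => exp (-G x y)) volume) (y : Euc d) (g : Euc d → ℝ) :
    Integrable g (condDist G y) ↔ Integrable fun x => condDensity G y x * g x := by
  rw [condDist, integrable_withDensity_iff_integrable_smul'
    (measurable_condDensity_right hG y).ennreal_ofReal
    (Eventually.of_forall fun x => ENNReal.ofReal_lt_top)]
  simp_rw [ENNReal.toReal_ofReal (condDensity_pos hZ y _).le, smul_eq_mul]

/-- The conditional distributions as a kernel. -/
def condKernel (hG : Measurable (Function.uncurry G)) : ProbabilityTheory.Kernel (Euc d) (Euc d) :=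
  ⟨condDist G, measurable_condDist hG⟩

theorem isMarkovKernel_condKernel (hG : Measurable (Function.uncurry G))
    (hZ : ∀ y, Integrable (fun x => exp (-G x y)) volume) :
    ProbabilityTheory.IsMarkovKernel (condKernel hG) :=
  ⟨fun y => isProbabilityMeasure_condDist hZ y⟩

theorem isProbabilityMeasure_mixture (hG : Measurable (Function.uncurry G))
    (hZ : ∀ y, Integrable (fun x => exp (-G x y)) volume)
    (ρ : Measure (Euc d)) [IsProbabilityMeasure ρ] : IsProbabilityMeasure (mixture ρ G) := by
  have := isMarkovKernel_condKernel hG hZ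
  exact inferInstanceAs (IsProbabilityMeasure (ρ.bind (condKernel hG)))

theorem integral_mixture (hG : Measurable (Function.uncurry G))
    {ρ : Measure (Euc d)} {g : Euc d → ℝ} (hg : Integrable g (mixture ρ G)) :
    ∫ x, g x ∂(mixture ρ G) = ∫ y, ∫ x, g x ∂(condDist G y) ∂ρ :=
  ProbabilityTheory.Kernel.integral_comp (η := condKernel hG)
    (κ := ProbabilityTheory.Kernel.const Unit ρ) (a := ()) hg

theorem measurable_integral_condDist (hG : Measurable (Function.uncurry G))
    {g : Euc d → ℝ} (hg : Measurable g) : Measurable fun y => ∫ x, g x ∂(condDist G y) :=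
  (StronglyMeasurable.integral_kernel (κ := condKernel hG) hg.stronglyMeasurable).measurable

/-! ### The score -/

theorem inner_score (u y x : Euc d) :
    inner ℝ u (score G y x) = fderiv ℝ (fun y' => log (condDensity G y' x)) y u := by
  rw [real_inner_comm]
  exact inner_gradient_left

/-- A directional derivative is the limit of difference quotients with steps `1 / n`, each jointly
measurable in both variables. -/
theorem measurable_inner_score (hG : Measurable (Function.uncurry G))
    (hdiff : ∀ x, Differentiable ℝ (fun y => log (condDensity G y x))) (u : Euc d) :
    Measurable fun z : Euc d × Euc d => inner ℝ u (score G z.1 z.2) := by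
  refine measurable_of_tendsto_metrizable (f := fun (n : ℕ) (z : Euc d × Euc d) =>
    (n : ℝ) • (log (condDensity G (z.1 + (n : ℝ)⁻¹ • u) z.2) - log (condDensity G z.1 z.2)))
    (fun n => ?_) (tendsto_pi_nhds.2 fun z => ?_)
  · have h1 : Measurable fun z : Euc d × Euc d => (z.1 + (n : ℝ)⁻¹ • u, z.2) :=
      (measurable_fst.add_const _).prodMk measurable_snd
    simp only [smul_eq_mul]
    exact ((((measurable_condDensity hG).comp h1).log).sub
      (measurable_condDensity hG).log).const_mul _
  · rw [inner_score]
    exact ((hdiff z.2 z.1).hasFDerivAt.lim_real u).comp tendsto_natCast_atTop_atTop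

theorem hasDerivAt_condDensity_line
    (hZ : ∀ y, Integrable (fun x => exp (-G x y)) volume)
    (hdiff : ∀ x, Differentiable ℝ (fun y => log (condDensity G y x))) (u y x : Euc d) (s : ℝ) :
    HasDerivAt (fun t : ℝ => condDensity G (y + t • u) x)
      (condDensity G (y + s • u) x * inner ℝ u (score G (y + s • u) x)) s := by
  have h1 : HasDerivAt (fun t : ℝ => y + t • u) u s := by
    simpa using ((hasDerivAt_id s).smul_const u).const_add y
  have h2 := ((hdiff x (y + s • u)).hasFDerivAt.comp_hasDerivAt s h1).exp
  rw [inner_score]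
  simpa only [Function.comp_apply, exp_log (condDensity_pos hZ _ x)] using h2

/-- The scores have bounded first absolute moments. -/
def ScoreBound (G : Euc d → Euc d → ℝ) (C : ℝ) : Prop :=
  ∀ u y : Euc d, Integrable (fun x => inner ℝ u (score G y x)) (condDist G y) ∧
    ∫ x, |inner ℝ u (score G y x)| ∂(condDist G y) ≤ C * ‖u‖

theorem integrable_mul_inner_score {C A : ℝ} (hs : ScoreBound G C) {f : Euc d → ℝ}
    (hf : Measurable f) (hfA : ∀ x, |f x| ≤ A) (u y : Euc d) :
    Integrable (fun x => f x * inner ℝ u (score G y x)) (condDist G y) :=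
  (hs u y).1.bdd_mul hf.aestronglyMeasurable (Eventually.of_forall hfA)

theorem abs_integral_mul_inner_score_le {C A : ℝ} (hs : ScoreBound G C) {f : Euc d → ℝ}
    (hfA : ∀ x, |f x| ≤ A) (u y : Euc d) :
    |∫ x, f x * inner ℝ u (score G y x) ∂(condDist G y)| ≤ A * (C * ‖u‖) := by
  have hA : 0 ≤ A := (abs_nonneg _).trans (hfA 0)
  calc |∫ x, f x * inner ℝ u (score G y x) ∂(condDist G y)|
      ≤ ∫ x, A * |inner ℝ u (score G y x)| ∂(condDist G y) := by
        rw [← Real.norm_eq_abs]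
        refine norm_integral_le_of_norm_le ((hs u y).1.abs.const_mul A)
          (Eventually.of_forall fun x => ?_)
        rw [norm_mul]
        exact mul_le_mul_of_nonneg_right (hfA x) (abs_nonneg _)
    _ ≤ A * (C * ‖u‖) := by
        rw [integral_const_mul]
        exact mul_le_mul_of_nonneg_left (hs u y).2 hA

theorem measurable_integral_mul_inner_score (hG : Measurable (Function.uncurry G))
    (hZ : ∀ y, Integrable (fun x => exp (-G x y)) volume)
    (hdiff : ∀ x, Differentiable ℝ (fun y => log (condDensity G y x))) {f : Euc d → ℝ}
    (hf : Measurable f) (u : Euc d) :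
    Measurable fun y => ∫ x, f x * inner ℝ u (score G y x) ∂(condDist G y) := by
  simp_rw [integral_condDist hG hZ]
  exact (StronglyMeasurable.integral_prod_right (ν := volume)
    (f := fun y x => condDensity G y x * (f x * inner ℝ u (score G y x)))
    ((measurable_condDensity hG).mul ((hf.comp measurable_snd).mul
      (measurable_inner_score hG hdiff u))).stronglyMeasurable).measurable

/-- Conditional expectations of bounded functions satisfy the fundamental theorem of calculus
along lines, with the formal derivative under the integral sign. -/
theorem integral_condDist_sub (hG : Measurable (Function.uncurry G))
    (hZ : ∀ y, Integrable (fun x => exp (-G x y)) volume)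
    (hdiff : ∀ x, Differentiable ℝ (fun y => log (condDensity G y x)))
    {C A : ℝ} (hs : ScoreBound G C) {f : Euc d → ℝ}
    (hf : Measurable f) (hfA : ∀ x, |f x| ≤ A) (u y : Euc d) (t : ℝ) :
    ∫ x, f x ∂(condDist G (y + t • u)) - ∫ x, f x ∂(condDist G y) =
      ∫ s in (0 : ℝ)..t, ∫ x, f x * inner ℝ u (score G (y + s • u) x)
        ∂(condDist G (y + s • u)) := by
  set H : ℝ → Euc d → ℝ := fun s x =>
    condDensity G (y + s • u) x * inner ℝ u (score G (y + s • u) x) with hH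
  have hHm : Measurable (Function.uncurry H) := by
    have h1 : Measurable fun z : ℝ × Euc d => (y + z.1 • u, z.2) :=
      ((measurable_fst.smul_const u).const_add y).prodMk measurable_snd
    have h2 : Measurable fun z : ℝ × Euc d => condDensity G (y + z.1 • u) z.2 :=
      (measurable_condDensity hG).comp h1
    have h3 := (measurable_inner_score hG hdiff u).comp h1
    simp only [Function.comp_def] at h3
    exact h2.mul h3
  have hnorm : ∀ s, ∫ x, ‖H s x‖ = ∫ x, |inner ℝ u (score G (y + s • u) x)|
      ∂(condDist G (y + s • u)) := by
    intro s
    rw [integral_condDist hG hZ]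
    simp_rw [hH, norm_mul, Real.norm_of_nonneg (condDensity_pos hZ _ _).le, Real.norm_eq_abs]
  -- The score bound is uniform along the segment. This gives Fubini and, for almost every `x`,
  -- integrability in `s` of the derivative of the density, which suffices for the fundamental
  -- theorem of calculus without continuity.
  have hHint : Integrable (Function.uncurry H)
      ((volume.restrict (Set.uIoc 0 t)).prod volume) := by
    rw [integrable_prod_iff hHm.aestronglyMeasurable]
    refine ⟨Eventually.of_forall fun s =>
      (integrable_condDist_iff hG hZ _ _).1 (hs u (y + s • u)).1, ?_⟩
    have : IsFiniteMeasure (volume.restrict (Set.uIoc 0 t)) :=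
      ⟨by rw [Measure.restrict_apply_univ, Set.uIoc]; exact measure_Ioc_lt_top⟩
    refine Integrable.of_bound (C := C * ‖u‖) ?_ (Eventually.of_forall fun s => ?_)
    · exact (StronglyMeasurable.integral_prod_right (ν := volume) (f := fun s x => ‖H s x‖)
        hHm.norm.stronglyMeasurable).aestronglyMeasurable
    · simp only [Function.uncurry_apply_pair]
      rw [Real.norm_of_nonneg (integral_nonneg fun _ => norm_nonneg _), hnorm]
      exact (hs u _).2
  have hfHint : Integrable (Function.uncurry fun s x => f x * H s x)
      ((volume.restrict (Set.uIoc 0 t)).prod volume) :=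
    hHint.bdd_mul (hf.comp measurable_snd).aestronglyMeasurable
      (Eventually.of_forall fun z => hfA z.2)
  have hfp : ∀ y', Integrable fun x => condDensity G y' x * f x := fun y' => by
    simp_rw [mul_comm _ (f _)]
    exact (integrable_condDensity hZ y').bdd_mul hf.aestronglyMeasurable
      (Eventually.of_forall hfA)
  rw [integral_condDist hG hZ, integral_condDist hG hZ, ← integral_sub (hfp _) (hfp _),
    intervalIntegral.intervalIntegral_eq_integral_uIoc]
  have hR : ∀ s, ∫ x, f x * inner ℝ u (score G (y + s • u) x) ∂(condDist G (y + s • u)) =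
      ∫ x, f x * H s x := by
    intro s
    rw [integral_condDist hG hZ]
    exact integral_congr_ae (Eventually.of_forall fun x => by simp only [hH]; ring)
  simp_rw [hR]
  rw [integral_integral_swap hfHint, ← integral_smul]
  refine integral_congr_ae ?_
  filter_upwards [hHint.prod_left_ae] with x hx
  have hFTC := intervalIntegral.integral_eq_sub_of_hasDerivAt (a := 0) (b := t)
    (fun s _ => hasDerivAt_condDensity_line hZ hdiff u y x s)
    (intervalIntegrable_iff.2 hx)
  rw [intervalIntegral.intervalIntegral_eq_integral_uIoc, zero_smul, add_zero] at hFTC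
  rw [integral_const_mul, ← sub_mul, ← hFTC, smul_eq_mul, smul_eq_mul]
  simp only [hH]
  ring

/-- Along the segment from `z` to `y` the formal derivative is at most `A * C * ‖y - z‖`. -/
theorem lipschitzWith_integral_condDist (hG : Measurable (Function.uncurry G))
    (hZ : ∀ y, Integrable (fun x => exp (-G x y)) volume)
    (hdiff : ∀ x, Differentiable ℝ (fun y => log (condDensity G y x)))
    {C A : ℝ} (hs : ScoreBound G C) {f : Euc d → ℝ}
    (hf : Measurable f) (hfA : ∀ x, |f x| ≤ A) :
    LipschitzWith (A * C).toNNReal fun y => ∫ x, f x ∂(condDist G y) := by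
  refine LipschitzWith.of_dist_le_mul fun y z => ?_
  have h := integral_condDist_sub hG hZ hdiff hs hf hfA (y - z) z 1
  rw [one_smul, add_sub_cancel] at h
  rw [Real.dist_eq, h, dist_eq_norm]
  have h1 := intervalIntegral.norm_integral_le_of_norm_le_const (a := 0) (b := 1)
    (f := fun s : ℝ => ∫ x, f x * inner ℝ (y - z) (score G (z + s • (y - z)) x)
        ∂(condDist G (z + s • (y - z)))) (C := A * (C * ‖y - z‖))
    fun s _ => abs_integral_mul_inner_score_le hs hfA _ _
  rw [sub_zero, abs_one, mul_one, Real.norm_eq_abs] at h1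
  refine h1.trans ?_
  rw [← mul_assoc]
  exact mul_le_mul_of_nonneg_right (Real.le_coe_toNNReal _) (norm_nonneg _)

/-- Almost everywhere, differentiation under the integral sign is valid for conditional
expectations of bounded functions. -/
theorem ae_fderiv_integral_condDist (hG : Measurable (Function.uncurry G))
    (hZ : ∀ y, Integrable (fun x => exp (-G x y)) volume)
    (hdiff : ∀ x, Differentiable ℝ (fun y => log (condDensity G y x)))
    {C A : ℝ} (hs : ScoreBound G C) {f : Euc d → ℝ}
    (hf : Measurable f) (hfA : ∀ x, |f x| ≤ A) (u : Euc d) :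
    ∀ᵐ y : Euc d, fderiv ℝ (fun y' => ∫ x, f x ∂(condDist G y')) y u =
      ∫ x, f x * inner ℝ u (score G y x) ∂(condDist G y) := by
  set F : Euc d → ℝ := fun y => ∫ x, f x ∂(condDist G y) with hF
  set g : Euc d → ℝ := fun y => ∫ x, f x * inner ℝ u (score G y x) ∂(condDist G y) with hg
  have hFK := lipschitzWith_integral_condDist hG hZ hdiff hs hf hfA
  have hgm : Measurable g := measurable_integral_mul_inner_score hG hZ hdiff hf u
  -- On each line parallel to `u`, Lebesgue differentiation of the integral formula gives the
  -- derivative at almost every point; Fubini over these lines makes the exceptional set null.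
  have hline : ∀ᵐ y : Euc d, y ∈ {y | lineDeriv ℝ F y u = g y} := by
    refine ae_mem_of_ae_add_linearMap_mem
      (ContinuousLinearMap.toSpanSingleton ℝ u).toLinearMap volume volume
      (measurableSet_eq_fun (measurable_lineDeriv hFK.continuous) hgm) fun y => ?_
    have hloc : LocallyIntegrable (fun s : ℝ => g (y + s • u)) := by
      refine MemLp.locallyIntegrable (p := ⊤) ?_ le_top
      refine memLp_top_of_bound (C := A * (C * ‖u‖)) ?_ (Eventually.of_forall fun s =>
        abs_integral_mul_inner_score_le hs hfA _ _)
      exact (hgm.comp ((measurable_id.smul_const u).const_add y)).aestronglyMeasurable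
    filter_upwards [LocallyIntegrable.ae_hasDerivAt_integral hloc] with s hds
    have h1 : HasDerivAt (fun t : ℝ => F (y + t • u)) (g (y + s • u)) s := by
      refine ((hds 0).const_add (F y)).congr_of_eventuallyEq (Eventually.of_forall fun t => ?_)
      simp only
      rw [← integral_condDist_sub hG hZ hdiff hs hf hfA u y t]
      simp only [hF]
      ring
    have h2 : HasDerivAt (fun t : ℝ => F (y + s • u + t • u)) (g (y + s • u)) 0 := by
      have h3 : HasDerivAt (fun t : ℝ => F (y + t • u)) (g (y + s • u)) (s + 0) := by
        rwa [add_zero]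
      refine (h3.comp_const_add s 0).congr_of_eventuallyEq (Eventually.of_forall fun t => ?_)
      simp only [add_smul, add_assoc]
    exact h2.deriv
  filter_upwards [hline, hFK.ae_differentiableAt] with y hy hy'
  rw [← hy'.lineDeriv_eq_fderiv]
  exact hy

/-- A bound on the directional derivatives in a dense set of directions is a bound on the norm of
the derivative. -/
theorem ae_norm_fderiv_integral_condDist_le (hG : Measurable (Function.uncurry G))
    (hZ : ∀ y, Integrable (fun x => exp (-G x y)) volume)
    (hdiff : ∀ x, Differentiable ℝ (fun y => log (condDensity G y x)))
    {C A : ℝ} (hs : ScoreBound G C) {f : Euc d → ℝ}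
    (hf : Measurable f) (hfA : ∀ x, |f x| ≤ A) {b : Euc d → ℝ} (hb : ∀ y, 0 ≤ b y)
    (h : ∀ u, ∀ᵐ y : Euc d,
      |∫ x, f x * inner ℝ u (score G y x) ∂(condDist G y)| ≤ b y * ‖u‖) :
    ∀ᵐ y : Euc d, ‖fderiv ℝ (fun y' => ∫ x, f x ∂(condDist G y')) y‖ ≤ b y := by
  -- The exceptional null set depends on the direction, so only countably many directions can be
  -- treated at once.
  have h1 : ∀ n : ℕ, ∀ᵐ y : Euc d, |fderiv ℝ (fun y' => ∫ x, f x ∂(condDist G y')) y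
      (TopologicalSpace.denseSeq (Euc d) n)| ≤ b y * ‖TopologicalSpace.denseSeq (Euc d) n‖ := by
    intro n
    filter_upwards [h (TopologicalSpace.denseSeq (Euc d) n),
      ae_fderiv_integral_condDist hG hZ hdiff hs hf hfA (TopologicalSpace.denseSeq (Euc d) n)]
      with y hy hy'
    rwa [hy']
  filter_upwards [ae_all_iff.2 h1] with y hy
  refine ContinuousLinearMap.opNorm_le_bound _ (hb y) fun u => ?_
  refine (TopologicalSpace.denseRange_denseSeq (Euc d)).induction_on
    (p := fun u => ‖fderiv ℝ (fun y' => ∫ x, f x ∂(condDist G y')) y u‖ ≤ b y * ‖u‖) u ?_ hy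
  exact isClosed_le (ContinuousLinearMap.continuous _).norm (continuous_const.mul continuous_norm)

end Conditional

/-! ### Duality inequalities for the conditional distributions -/

/-- The integral of `(t f + g)²` is a nonnegative quadratic in `t`, so its discriminant is
nonpositive. -/
theorem sq_integral_mul_le {Ω : Type*} [MeasurableSpace Ω] {ν : Measure Ω} {f g : Ω → ℝ}
    (hf : Integrable (fun x => f x ^ 2) ν) (hg : Integrable (fun x => g x ^ 2) ν)
    (hfg : Integrable (fun x => f x * g x) ν) :
    (∫ x, f x * g x ∂ν) ^ 2 ≤ (∫ x, f x ^ 2 ∂ν) * ∫ x, g x ^ 2 ∂ν := by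
  have h : ∀ t : ℝ, 0 ≤ (∫ x, f x ^ 2 ∂ν) * (t * t) + (2 * ∫ x, f x * g x ∂ν) * t +
      ∫ x, g x ^ 2 ∂ν := by
    intro t
    have h0 : 0 ≤ ∫ x, (f x * t + g x) ^ 2 ∂ν := integral_nonneg fun x => sq_nonneg _
    have h1 : ∀ x, (f x * t + g x) ^ 2 =
        f x ^ 2 * (t * t) + f x * g x * (2 * t) + g x ^ 2 := fun x => by ring
    simp_rw [h1] at h0
    have hsum : Integrable (fun x => f x ^ 2 * (t * t) + f x * g x * (2 * t)) ν :=
      (hf.mul_const _).add (hfg.mul_const _)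
    rw [integral_add hsum hg,
      integral_add (hf.mul_const _) (hfg.mul_const _), integral_mul_const,
      integral_mul_const] at h0
    linarith
  have := discrim_le_zero h
  rw [discrim] at this
  linarith

/-- Young's inequality for the conjugate pair `a log a - a` and `exp b`, from `1 + s ≤ exp s` at `s
= b - log a`. -/
theorem mul_le_mul_log_sub_add_exp {a : ℝ} (ha : 0 < a) (b : ℝ) :
    a * b ≤ a * log a - a + exp b := by
  have h := mul_le_mul_of_nonneg_left (add_one_le_exp (b - log a)) ha.le
  rw [exp_sub, exp_log ha, mul_div_cancel₀ _ ha.ne'] at h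
  linarith

/-- The Donsker–Varadhan inequality for densities bounded away from zero and infinity. -/
theorem integral_mul_le_entropy_add {Ω : Type*} [MeasurableSpace Ω] {ν : Measure Ω}
    [IsProbabilityMeasure ν] {h X : Ω → ℝ} {m M : ℝ} (hm : 0 < m) (hh : AEMeasurable h ν)
    (hhm : ∀ x, h x ∈ Set.Icc m M) (hX : Integrable X ν)
    (hexp : Integrable (fun x => exp (X x)) ν) :
    ∫ x, h x * X x ∂ν ≤ (∫ x, h x * log (h x) ∂ν) - (∫ x, h x ∂ν) * log (∫ x, h x ∂ν) +
      (∫ x, h x ∂ν) * log (∫ x, exp (X x) ∂ν) := by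
  have hhi : Integrable h ν := Integrable.of_mem_Icc m M hh (Eventually.of_forall hhm)
  have hhlog : Integrable (fun x => h x * log (h x)) ν := by
    obtain ⟨B, hB⟩ := isCompact_Icc.exists_bound_of_continuousOn
      (continuous_mul_log.continuousOn (s := Set.Icc m M))
    exact Integrable.of_bound (hh.mul hh.log).aestronglyMeasurable B
      (Eventually.of_forall fun x => hB _ (hhm x))
  have hhX : Integrable (fun x => h x * X x) ν :=
    hX.bdd_mul hh.aestronglyMeasurable
      (Eventually.of_forall fun x => abs_le_max_abs_abs (hhm x).1 (hhm x).2)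
  set F := ∫ x, h x ∂ν with hF
  set E := ∫ x, exp (X x) ∂ν with hE
  have hF0 : 0 < F := hm.trans_le <| by
    have := integral_mono (integrable_const m) hhi fun x => (hhm x).1
    simpa using this
  have hE0 : 0 < E := integral_exp_pos hexp
  -- Young's inequality is applied to the normalised quantities `h / F` and `X - log E`; after
  -- integration the terms `-F` and `F` cancel.
  have key : ∀ x, h x * X x ≤
      h x * log (h x) + h x * (log E - log F - 1) + exp (X x) * (F / E) := by
    intro x
    have hx : 0 < h x := hm.trans_le (hhm x).1
    have := mul_le_mul_log_sub_add_exp (div_pos hx hF0) (X x - log E)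
    rw [log_div hx.ne' hF0.ne', exp_sub, exp_log hE0] at this
    have h2 := mul_le_mul_of_nonneg_left this hF0.le
    have e1 : F * (h x / F * (X x - log E)) = h x * (X x - log E) := by field_simp
    have e2 : F * (h x / F * (log (h x) - log F) - h x / F + exp (X x) / E) =
      h x * (log (h x) - log F) - h x + exp (X x) * (F / E) := by field_simp
    rw [e1, e2] at h2
    linarith
  have hsum : Integrable (fun x => h x * log (h x) + h x * (log E - log F - 1)) ν :=
    hhlog.add (hhi.mul_const _)
  have hint := integral_mono hhX (hsum.add (hexp.mul_const (F / E))) key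
  simp only [Pi.add_apply] at hint
  rw [integral_add hsum (hexp.mul_const _),
    integral_add hhlog (hhi.mul_const _), integral_mul_const, integral_mul_const, ← hF, ← hE,
    mul_div_cancel₀ _ hE0.ne'] at hint
  linarith

/-! ### The two-scale decomposition -/

section TwoScale

variable {d : ℕ} {G : Euc d → Euc d → ℝ}

theorem exists_bound_of_hasCompactSupport_sub {h : Euc d → ℝ} {c : ℝ} (hh : Continuous h)
    (hc : HasCompactSupport fun x => h x - c) : ∃ A, ∀ x, |h x| ≤ A := by
  obtain ⟨A, hA⟩ := hc.exists_bound_of_continuous (hh.sub continuous_const)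
  refine ⟨A + |c|, fun x => ?_⟩
  have := abs_add_le (h x - c) c
  rw [sub_add_cancel] at this
  exact this.trans (add_le_add_left (hA x) _)

theorem exists_bound_fderiv_of_hasCompactSupport_sub {h : Euc d → ℝ} {c : ℝ}
    (hh : ContDiff ℝ ∞ h) (hc : HasCompactSupport fun x => h x - c) :
    ∃ A, ∀ x, ‖fderiv ℝ h x‖ ≤ A := by
  have h1 : HasCompactSupport (fderiv ℝ h) := by
    have : fderiv ℝ h = fderiv ℝ fun x => h x - c := by
      ext1 x
      exact (fderiv_sub_const c).symm
    rw [this]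
    exact hc.fderiv ℝ
  exact h1.exists_bound_of_continuous (hh.continuous_fderiv (by simp))

/-- The two-scale principle: a `Φ`-Sobolev inequality for the conditional distributions and one
for the mixing measure combine when the Fisher information of the conditional expectation is
controlled by the averaged conditional Fisher information. -/
theorem phiEnt_mixture_le {ρ : Measure (Euc d)} [IsProbabilityMeasure ρ]
    (hρ : ρ ≪ volume) (hG : Measurable (Function.uncurry G))
    (hZ : ∀ y, Integrable (fun x => exp (-G x y)) volume)
    (hdiff : ∀ x, Differentiable ℝ (fun y => log (condDensity G y x)))
    {C : ℝ} (hs : ScoreBound G C) {S : Set ℝ} {Φ : ℝ → ℝ} {α β L m M c : ℝ} (hα : 0 < α)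
    (hΦSI : PhiSI S Φ α ρ) (hS : Set.Icc m M ⊆ S) (hΦ : ContinuousOn Φ (Set.Icc m M))
    (hΦ2 : ContinuousOn (deriv (deriv Φ)) (Set.Icc m M)) {h : Euc d → ℝ} (hh : ContDiff ℝ ∞ h)
    (hc : HasCompactSupport fun x => h x - c) (hhm : ∀ x, h x ∈ Set.Icc m M)
    (hcond : ∀ y, phiEnt (condDist G y) Φ h ≤
      β / 2 * ∫ x, deriv (deriv Φ) (h x) * ‖gradient h x‖ ^ 2 ∂(condDist G y))
    (hgrad : ∀ᵐ y : Euc d, deriv (deriv Φ) (∫ x, h x ∂(condDist G y)) *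
        ‖fderiv ℝ (fun y' => ∫ x, h x ∂(condDist G y')) y‖ ^ 2 ≤
      β * L ^ 2 * ∫ x, deriv (deriv Φ) (h x) * ‖gradient h x‖ ^ 2 ∂(condDist G y)) :
    phiEnt (mixture ρ G) Φ h ≤ (β + α * β * L ^ 2) / 2 *
      ∫ x, deriv (deriv Φ) (h x) * ‖gradient h x‖ ^ 2 ∂(mixture ρ G) := by
  have hmix := isProbabilityMeasure_mixture hG hZ ρ
  have hprob := isProbabilityMeasure_condDist hZ
  obtain ⟨A, hA⟩ := exists_bound_of_hasCompactSupport_sub hh.continuous hc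
  obtain ⟨A', hA'⟩ := exists_bound_fderiv_of_hasCompactSupport_sub hh hc
  obtain ⟨B, hB⟩ := isCompact_Icc.exists_bound_of_continuousOn hΦ
  obtain ⟨B2, hB2⟩ := isCompact_Icc.exists_bound_of_continuousOn hΦ2
  have hB20 : 0 ≤ B2 := (norm_nonneg _).trans (hB2 _ (hhm 0))
  set F : Euc d → ℝ := fun y => ∫ x, h x ∂(condDist G y) with hF
  set D : Euc d → ℝ := fun x => deriv (deriv Φ) (h x) * ‖gradient h x‖ ^ 2 with hD
  have hΦm : Measurable fun x => Φ (h x) :=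
    (continuous_comp_of_mem_Icc hΦ hh.continuous hhm).measurable
  have hDm : Measurable D :=
    (continuous_comp_of_mem_Icc hΦ2 hh.continuous hhm).measurable.mul
      (measurable_norm_gradient_sq h)
  have hDB : ∀ x, |D x| ≤ B2 * A' ^ 2 := by
    intro x
    rw [hD, abs_mul, abs_pow, abs_norm, norm_gradient_eq_norm_fderiv]
    gcongr
    · exact hB2 _ (hhm x)
    · exact hA' x
  have hint : ∀ {g : Euc d → ℝ} {b : ℝ}, Measurable g → (∀ x, |g x| ≤ b) →
      ∀ ν : Measure (Euc d), IsProbabilityMeasure ν → Integrable g ν := fun hg hb ν _ =>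
    Integrable.of_bound hg.aestronglyMeasurable _ (Eventually.of_forall hb)
  have hbd : ∀ {g : Euc d → ℝ} {b : ℝ}, (∀ x, |g x| ≤ b) →
      ∀ y, |∫ x, g x ∂(condDist G y)| ≤ b := by
    intro g b hb y
    have := norm_integral_le_of_norm_le_const (μ := condDist G y)
      (f := g) (C := b) (Eventually.of_forall hb)
    simpa using this
  have hFm : ∀ y, F y ∈ Set.Icc m M := fun y =>
    (convex_Icc m M).integral_mem isClosed_Icc (Eventually.of_forall hhm)
      (hint hh.continuous.measurable hA _ (hprob y))
  -- `F` is only known to be Lipschitz, hence the extended form of the inequality for `ρ`.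
  have hFK := lipschitzWith_integral_condDist hG hZ hdiff hs hh.continuous.measurable hA
  have hFSI := hΦSI.of_lipschitz hρ hS hΦ hΦ2 hFm hFK
  have hΦF : Continuous fun y => Φ (F y) := continuous_comp_of_mem_Icc hΦ hFK.continuous hFm
  have i1 : Integrable (fun y => ∫ x, Φ (h x) ∂(condDist G y)) ρ :=
    hint (measurable_integral_condDist hG hΦm) (hbd fun x => hB _ (hhm x)) ρ inferInstance
  have i2 : Integrable (fun y => Φ (F y)) ρ :=
    hint hΦF.measurable (fun y => hB _ (hFm y)) ρ inferInstance
  have i3 : Integrable (fun y => ∫ x, D x ∂(condDist G y)) ρ :=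
    hint (measurable_integral_condDist hG hDm) (hbd hDB) ρ inferInstance
  have i4 : Integrable (fun y => deriv (deriv Φ) (F y) * ‖gradient F y‖ ^ 2) ρ := by
    refine hint (g := fun y => deriv (deriv Φ) (F y) * ‖gradient F y‖ ^ 2)
      (b := B2 * ((A * C).toNNReal : ℝ) ^ 2)
      ((continuous_comp_of_mem_Icc hΦ2 hFK.continuous hFm).measurable.mul
      (measurable_norm_gradient_sq F)) (fun y => ?_) ρ inferInstance
    rw [abs_mul, abs_pow, abs_norm, norm_gradient_eq_norm_fderiv]
    gcongr
    · exact hB2 _ (hFm y)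
    · exact norm_fderiv_le_of_lipschitz ℝ hFK
  have e1 := integral_mixture hG (hint hΦm (fun x => hB _ (hhm x)) _ hmix)
  have e2 := integral_mixture hG (hint hh.continuous.measurable hA _ hmix)
  have e3 := integral_mixture hG (hint hDm hDB _ hmix)
  have s1 : ∫ y, ((∫ x, Φ (h x) ∂(condDist G y)) - Φ (F y)) ∂ρ ≤
      ∫ y, β / 2 * ∫ x, D x ∂(condDist G y) ∂ρ :=
    integral_mono (i1.sub i2) (i3.const_mul _) hcond
  have s2 : ∫ y, deriv (deriv Φ) (F y) * ‖gradient F y‖ ^ 2 ∂ρ ≤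
      ∫ y, β * L ^ 2 * ∫ x, D x ∂(condDist G y) ∂ρ := by
    refine integral_mono_ae i4 (i3.const_mul _) ?_
    filter_upwards [hρ.ae_le hgrad] with y hy
    rwa [norm_gradient_eq_norm_fderiv]
  rw [integral_sub i1 i2, integral_const_mul] at s1
  rw [integral_const_mul] at s2
  rw [phiEnt] at hFSI ⊢
  rw [e1, e2, e3]
  have s3 := mul_le_mul_of_nonneg_left s2 (half_pos hα).le
  calc _ ≤ β / 2 * (∫ y, ∫ x, D x ∂(condDist G y) ∂ρ) +
        α / 2 * (β * L ^ 2 * ∫ y, ∫ x, D x ∂(condDist G y) ∂ρ) := by linarith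
    _ = _ := by ring

/-- The conditional mean of the constant `1` does not depend on `y`, so its derivative vanishes; the
derivative formula is available almost everywhere. -/
theorem integral_inner_score_ae_eq_zero (hG : Measurable (Function.uncurry G))
    (hZ : ∀ y, Integrable (fun x => exp (-G x y)) volume)
    (hdiff : ∀ x, Differentiable ℝ (fun y => log (condDensity G y x)))
    {C : ℝ} (hs : ScoreBound G C) (u : Euc d) :
    ∀ᵐ y : Euc d, ∫ x, inner ℝ u (score G y x) ∂(condDist G y) = 0 := by
  have hprob := isProbabilityMeasure_condDist hZ
  filter_upwards [ae_fderiv_integral_condDist hG hZ hdiff hs (f := fun _ => 1)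
    measurable_const (A := 1) (by simp) u] with y hy
  simpa using hy.symm

theorem measurable_inner_score_right (hG : Measurable (Function.uncurry G))
    (hdiff : ∀ x, Differentiable ℝ (fun y => log (condDensity G y x))) (u y : Euc d) :
    Measurable fun x => inner ℝ u (score G y x) := by
  have h := (measurable_inner_score hG hdiff u).comp (measurable_prodMk_left (x := y))
  simpa only [Function.comp_def] using h

theorem VarCriterion.scoreBound (hG : Measurable (Function.uncurry G))
    (hZ : ∀ y, Integrable (fun x => exp (-G x y)) volume)
    (hdiff : ∀ x, Differentiable ℝ (fun y => log (condDensity G y x)))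
    {L : ℝ} (hL : 0 < L) (h : VarCriterion G L) : ScoreBound G L := by
  intro u y
  have hprob := isProbabilityMeasure_condDist hZ y
  obtain ⟨h1, h2⟩ := h u y
  have hi : Integrable (fun x => inner ℝ u (score G y x)) (condDist G y) := by
    refine ((integrable_const (1 : ℝ)).add h1).mono'
      (measurable_inner_score_right hG hdiff u y).aestronglyMeasurable
      (Eventually.of_forall fun x => ?_)
    simp only [Pi.add_apply, Real.norm_eq_abs]
    nlinarith [sq_abs (inner ℝ u (score G y x)), sq_nonneg (|inner ℝ u (score G y x)| - 1)]
  refine ⟨hi, abs_le_of_sq_le_sq' ?_ (by positivity) |>.2⟩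
  -- Cauchy–Schwarz against the constant `1` bounds the first moment by the second.
  have := sq_integral_mul_le (ν := condDist G y) (f := fun _ => (1 : ℝ))
    (g := fun x => |inner ℝ u (score G y x)|) (by simp) (by simpa using h1)
    (by simpa using hi.abs)
  simp only [one_mul, one_pow, sq_abs, integral_const, probReal_univ, smul_eq_mul] at this
  rw [mul_pow]
  exact this.trans h2

theorem MGFCriterion.integral_exp_le
    {L : ℝ} (hZ : ∀ y, Integrable (fun x => exp (-G x y)) volume)
    (h : MGFCriterion G L) (u y : Euc d) :
    ∫ x, exp (inner ℝ u (score G y x)) ∂(condDist G y) ≤ exp (L ^ 2 * ‖u‖ ^ 2 / 2) := by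
  have hprob := isProbabilityMeasure_condDist hZ y
  exact (log_le_iff_le_exp (integral_exp_pos (h u y).1)).1 (h u y).2

theorem MGFCriterion.scoreBound (hG : Measurable (Function.uncurry G))
    (hZ : ∀ y, Integrable (fun x => exp (-G x y)) volume)
    (hdiff : ∀ x, Differentiable ℝ (fun y => log (condDensity G y x)))
    {L : ℝ} (h : MGFCriterion G L) : ScoreBound G (2 * exp (L ^ 2 / 2)) := by
  intro u y
  by_cases hu : u = 0
  · simp [hu]
  have hu' : 0 < ‖u‖ := norm_pos_iff.2 hu
  -- The exponential is not homogeneous, so the moment bound is proved for unit vectors, from `|t| ≤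
  -- exp t + exp (-t)`, and then scaled.
  set v : Euc d := ‖u‖⁻¹ • u with hv
  have hv1 : ‖v‖ = 1 := by rw [hv, norm_smul, norm_inv, norm_norm, inv_mul_cancel₀ hu'.ne']
  have huv : ∀ x, inner ℝ u (score G y x) = ‖u‖ * inner ℝ v (score G y x) := by
    intro x
    rw [hv, real_inner_smul_left, mul_inv_cancel_left₀ hu'.ne']
  have hle : ∀ x, |inner ℝ v (score G y x)| ≤
      exp (inner ℝ v (score G y x)) + exp (inner ℝ (-v) (score G y x)) := by
    intro x
    rw [inner_neg_left]
    set t := inner ℝ v (score G y x)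
    have h1 := add_one_le_exp t
    have h2 := add_one_le_exp (-t)
    have h3 := exp_pos t
    have h4 := exp_pos (-t)
    exact abs_le.2 ⟨by linarith, by linarith⟩
  have hexp := (h v y).1.add (h (-v) y).1
  have hi : Integrable (fun x => inner ℝ v (score G y x)) (condDist G y) :=
    hexp.mono' (measurable_inner_score_right hG hdiff v y).aestronglyMeasurable
      (Eventually.of_forall hle)
  simp_rw [huv]
  refine ⟨hi.const_mul _, ?_⟩
  simp_rw [abs_mul, abs_norm]
  rw [integral_const_mul, mul_comm]
  refine mul_le_mul_of_nonneg_right ?_ (norm_nonneg _)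
  have h1 := h.integral_exp_le hZ v y
  have h2 := h.integral_exp_le hZ (-v) y
  rw [norm_neg] at h2
  rw [hv1, one_pow, mul_one] at h1 h2
  have h3 := integral_mono hi.abs hexp hle
  simp only [Pi.add_apply] at h3
  rw [integral_add (h v y).1 (h (-v) y).1] at h3
  linarith

theorem VarCriterion.ae_abs_integral_mul_le (hG : Measurable (Function.uncurry G))
    (hZ : ∀ y, Integrable (fun x => exp (-G x y)) volume)
    (hdiff : ∀ x, Differentiable ℝ (fun y => log (condDensity G y x)))
    {L A : ℝ} (hL : 0 < L) (h : VarCriterion G L) {f : Euc d → ℝ} (hf : Measurable f)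
    (hfA : ∀ x, |f x| ≤ A) (u : Euc d) :
    ∀ᵐ y : Euc d, |∫ x, f x * inner ℝ u (score G y x) ∂(condDist G y)| ≤
      L * √(phiEnt (condDist G y) (fun t => t ^ 2) f) * ‖u‖ := by
  have hs := h.scoreBound hG hZ hdiff hL
  filter_upwards [integral_inner_score_ae_eq_zero hG hZ hdiff hs u] with y hy
  have hprob := isProbabilityMeasure_condDist hZ y
  have hfi : Integrable f (condDist G y) :=
    Integrable.of_bound hf.aestronglyMeasurable _ (Eventually.of_forall hfA)
  have hf2 : Integrable (fun x => f x ^ 2) (condDist G y) := by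
    refine Integrable.of_bound (hf.pow_const 2).aestronglyMeasurable (A ^ 2)
      (Eventually.of_forall fun x => ?_)
    rw [norm_pow]
    exact pow_le_pow_left₀ (norm_nonneg _) (hfA x) 2
  set a := ∫ x, f x ∂(condDist G y) with ha
  have hsub : Integrable (fun x => f x ^ 2 - f x * (2 * a)) (condDist G y) :=
    hf2.sub (hfi.mul_const _)
  have hvar : ∫ x, (f x - a) ^ 2 ∂(condDist G y) =
      phiEnt (condDist G y) (fun t => t ^ 2) f := by
    have h1 : ∀ x, (f x - a) ^ 2 = f x ^ 2 - f x * (2 * a) + a ^ 2 := fun x => by ring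
    simp_rw [h1]
    rw [integral_add hsub (integrable_const _),
      integral_sub hf2 (hfi.mul_const _), integral_mul_const, ← ha, phiEnt, ← ha]
    simp
    ring
  have hfs := integrable_mul_inner_score hs hf hfA u y
  -- The score has mean zero, so `f` may be centred; Cauchy–Schwarz then sees the variance and not
  -- the second moment.
  have hcov : ∫ x, f x * inner ℝ u (score G y x) ∂(condDist G y) =
      ∫ x, (f x - a) * inner ℝ u (score G y x) ∂(condDist G y) := by
    simp_rw [sub_mul]
    rw [integral_sub hfs ((hs u y).1.const_mul a), integral_const_mul, hy, mul_zero, sub_zero]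
  have hsq2 : Integrable (fun x => (f x - a) ^ 2) (condDist G y) := by
    have h1 : ∀ x, (f x - a) ^ 2 = f x ^ 2 - f x * (2 * a) + a ^ 2 := fun x => by ring
    simp_rw [h1]
    exact hsub.add (integrable_const _)
  have hCS := sq_integral_mul_le hsq2 (h u y).1 (by
    simp_rw [sub_mul]
    exact hfs.sub ((hs u y).1.const_mul a))
  rw [← hcov, hvar] at hCS
  have hV : 0 ≤ phiEnt (condDist G y) (fun t => t ^ 2) f := by
    rw [← hvar]
    exact integral_nonneg fun x => sq_nonneg _
  refine abs_le_of_sq_le_sq ?_ (by positivity)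
  calc _ ≤ _ := hCS
    _ ≤ phiEnt (condDist G y) (fun t => t ^ 2) f * (L ^ 2 * ‖u‖ ^ 2) :=
        mul_le_mul_of_nonneg_left (h u y).2 hV
    _ = _ := by rw [mul_pow, mul_pow, sq_sqrt hV]; ring

/-- Donsker–Varadhan with the score in direction `t • u` gives a quadratic in `t` that is
nonnegative for all real `t`. Its value at `0` is the entropy, and its discriminant gives the second
bound. No centring is used, so every `y` is covered. -/
theorem MGFCriterion.entropy_nonneg_and_abs_integral_mul_le
    (hG : Measurable (Function.uncurry G))
    (hZ : ∀ y, Integrable (fun x => exp (-G x y)) volume)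
    (hdiff : ∀ x, Differentiable ℝ (fun y => log (condDensity G y x)))
    {L m M : ℝ} (hL : 0 < L) (hm : 0 < m) (h : MGFCriterion G L) {f : Euc d → ℝ}
    (hf : Measurable f) (hfm : ∀ x, f x ∈ Set.Icc m M) (u y : Euc d) :
    0 ≤ phiEnt (condDist G y) (fun t => t * log t) f ∧
      |∫ x, f x * inner ℝ u (score G y x) ∂(condDist G y)| ≤
        L * √(2 * phiEnt (condDist G y) (fun t => t * log t) f *
          ∫ x, f x ∂(condDist G y)) * ‖u‖ := by
  have hprob := isProbabilityMeasure_condDist hZ y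
  have hs := h.scoreBound hG hZ hdiff
  have hF0 : 0 ≤ ∫ x, f x ∂(condDist G y) :=
    integral_nonneg fun x => hm.le.trans (hfm x).1
  have key : ∀ t : ℝ, 0 ≤ ((∫ x, f x ∂(condDist G y)) * (L ^ 2 * ‖u‖ ^ 2 / 2)) * (t * t) +
      (-∫ x, f x * inner ℝ u (score G y x) ∂(condDist G y)) * t +
      phiEnt (condDist G y) (fun t => t * log t) f := by
    intro t
    have h1 := integral_mul_le_entropy_add (X := fun x => inner ℝ (t • u) (score G y x)) hm
      hf.aemeasurable hfm (hs (t • u) y).1 (h (t • u) y).1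
    have h2 := mul_le_mul_of_nonneg_left (h (t • u) y).2 hF0
    simp_rw [real_inner_smul_left, mul_left_comm _ t] at h1
    rw [integral_const_mul] at h1
    rw [norm_smul, mul_pow, Real.norm_eq_abs, sq_abs] at h2
    simp_rw [real_inner_smul_left] at h2
    rw [phiEnt]
    nlinarith
  have hE : 0 ≤ phiEnt (condDist G y) (fun t => t * log t) f := by simpa using key 0
  have hd := discrim_le_zero key
  refine ⟨hE, abs_le_of_sq_le_sq ?_ (by positivity)⟩
  rw [mul_pow, mul_pow, sq_sqrt (by positivity)]
  rw [discrim, neg_sq] at hd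
  linarith

end TwoScale

/-! ### Second derivatives of `Φ` and comparison of the constants -/

theorem deriv_deriv_sq (t : ℝ) : deriv (deriv fun t : ℝ => t ^ 2) t = 2 := by
  have h : deriv (fun t : ℝ => t ^ 2) = fun t => 2 * t := by
    ext t
    simp
  rw [h, deriv_const_mul_field, deriv_id'', mul_one]

theorem deriv_deriv_mul_log (t : ℝ) : deriv (deriv fun t : ℝ => t * log t) t = t⁻¹ :=
  Real.deriv2_mul_log t

/-- The constant of the two-scale criterion is strictly better than that of the joint
distribution. -/
theorem lt_jointConst {α β L : ℝ} (hα : 0 < α) (hβ : 0 < β) (hL : 0 < L) :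
    β + α * β * L ^ 2 < jointConst α β L := by
  set ξ := β + α * β * L ^ 2 with hξ
  have hξ0 : 0 < ξ := by positivity
  -- Strictness of an infimum needs a gap uniform in `C`. For `C ≤ K` the first entry exceeds `ξ` by
  -- at least `α L² β / K`; for `C ≥ K` the second exceeds it by at least `1`.
  set K := (ξ + 1) / α with hK
  have hK0 : 0 < K := by positivity
  have hδ : 0 < α * L ^ 2 * β / K := by positivity
  have hlt : ξ < ξ + min 1 (α * L ^ 2 * β / K) := lt_add_of_pos_right _ (lt_min one_pos hδ)
  refine hlt.trans_le ?_
  have : Nonempty (Set.Ioi (0 : ℝ)) := ⟨⟨1, Set.mem_Ioi.2 one_pos⟩⟩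
  refine le_ciInf fun C => ?_
  have hC : 0 < (C : ℝ) := C.2
  rcases le_total (C : ℝ) K with h | h
  · refine le_max_of_le_left ?_
    have h1 : K⁻¹ ≤ (C : ℝ)⁻¹ := inv_anti₀ hC h
    have h2 : α * L ^ 2 * β / K ≤ α * L ^ 2 * β * (C : ℝ)⁻¹ := by
      rw [div_eq_mul_inv]
      exact mul_le_mul_of_nonneg_left h1 (by positivity)
    have h3 := min_le_right 1 (α * L ^ 2 * β / K)
    calc _ ≤ ξ + α * L ^ 2 * β * (C : ℝ)⁻¹ := by linarith
      _ = _ := by rw [hξ]; ring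
  · refine le_max_of_le_right ?_
    have h1 : α * K = ξ + 1 := by rw [hK]; field_simp
    have h2 := mul_le_mul_of_nonneg_left h hα.le
    have h3 := min_le_left 1 (α * L ^ 2 * β / K)
    linarith

/-! ### Poincaré and log-Sobolev inequalities for the mixture -/

section Mixture

variable {d : ℕ} {ρ : Measure (Euc d)} [IsProbabilityMeasure ρ] {G : Euc d → Euc d → ℝ}
  {α β L : ℝ}

theorem poincare_mixture (hρ : ρ ≪ volume) (hG : Measurable (Function.uncurry G))
    (hZ : ∀ y, Integrable (fun x => exp (-G x y)) volume)
    (hdiff : ∀ x, Differentiable ℝ (fun y => log (condDensity G y x)))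
    (hα : 0 < α) (hL : 0 < L) (hSI : PhiSI Set.univ (fun t => t ^ 2) α ρ)
    (hcond : ∀ y, PhiSI Set.univ (fun t => t ^ 2) β (condDist G y))
    (hVar : VarCriterion G L) : PI (β + α * β * L ^ 2) (mixture ρ G) := by
  intro f hf hfc
  have hmix := isProbabilityMeasure_mixture hG hZ ρ
  have hc : HasCompactSupport fun x => f x - 0 := by simpa using hfc
  obtain ⟨A, hA⟩ := exists_bound_of_hasCompactSupport_sub hf.continuous hc
  have hs := hVar.scoreBound hG hZ hdiff hL
  have hfm := hf.continuous.measurable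
  have h2 : deriv (deriv fun t : ℝ => t ^ 2) = fun _ => 2 := funext deriv_deriv_sq
  have hloc : ∀ y, phiEnt (condDist G y) (fun t => t ^ 2) f ≤ β / 2 *
      ∫ x, deriv (deriv fun t => t ^ 2) (f x) * ‖gradient f x‖ ^ 2 ∂(condDist G y) :=
    fun y => hcond y f hf ⟨0, hc⟩ fun _ => Set.mem_univ _
  have hVnn : ∀ y, 0 ≤ phiEnt (condDist G y) (fun t => t ^ 2) f := by
    intro y
    have hprob := isProbabilityMeasure_condDist hZ y
    have hfL : MemLp f 2 (condDist G y) :=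
      MemLp.of_bound hfm.aestronglyMeasurable A (Eventually.of_forall hA)
    have := ProbabilityTheory.variance_eq_sub hfL
    exact (ProbabilityTheory.variance_nonneg f (condDist G y)).trans_eq this
  have key := phiEnt_mixture_le (β := β) (L := L) (m := -A) (M := A) hρ hG hZ hdiff hs hα hSI
    (Set.subset_univ _) (continuous_pow 2).continuousOn
    (by rw [h2]; exact continuousOn_const) hf hc (fun x => abs_le.1 (hA x)) hloc (by
      filter_upwards [ae_norm_fderiv_integral_condDist_le hG hZ hdiff hs hfm hA
        (b := fun y => L * √(phiEnt (condDist G y) (fun t => t ^ 2) f))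
        (fun y => by positivity) (hVar.ae_abs_integral_mul_le hG hZ hdiff hL hfm hA)] with y hy
      have h3 := pow_le_pow_left₀ (norm_nonneg _) hy 2
      rw [mul_pow, sq_sqrt (hVnn y)] at h3
      rw [deriv_deriv_sq]
      have h4 := mul_le_mul_of_nonneg_left (hloc y) (sq_nonneg L)
      linarith)
  have hfL : MemLp f 2 (mixture ρ G) :=
    MemLp.of_bound hfm.aestronglyMeasurable A (Eventually.of_forall hA)
  rw [ProbabilityTheory.variance_eq_sub hfL]
  refine key.trans_eq ?_
  simp_rw [deriv_deriv_sq]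
  rw [integral_const_mul]
  ring

/-- The lower bound `m > 0` keeps the values in a compact part of `(0, ∞)`, where `Φ'' = 1 / t` is
bounded. The factor `1 / F` cancels the mean in the Donsker–Varadhan gradient bound. -/
theorem phiEnt_mul_log_mixture_le (hρ : ρ ≪ volume) (hG : Measurable (Function.uncurry G))
    (hZ : ∀ y, Integrable (fun x => exp (-G x y)) volume)
    (hdiff : ∀ x, Differentiable ℝ (fun y => log (condDensity G y x)))
    (hα : 0 < α) (hL : 0 < L) (hSI : PhiSI (Set.Ioi 0) (fun t => t * log t) α ρ)
    (hcond : ∀ y, PhiSI (Set.Ioi 0) (fun t => t * log t) β (condDist G y))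
    (hMGF : MGFCriterion G L) {h : Euc d → ℝ} (hh : ContDiff ℝ ∞ h) {c m : ℝ}
    (hc : HasCompactSupport fun x => h x - c) (hm : 0 < m) (hhm : ∀ x, m ≤ h x) :
    phiEnt (mixture ρ G) (fun t => t * log t) h ≤ (β + α * β * L ^ 2) / 2 *
      ∫ x, (h x)⁻¹ * ‖gradient h x‖ ^ 2 ∂(mixture ρ G) := by
  have hmix := isProbabilityMeasure_mixture hG hZ ρ
  obtain ⟨A, hA⟩ := exists_bound_of_hasCompactSupport_sub hh.continuous hc
  have hs := hMGF.scoreBound hG hZ hdiff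
  have hhmeas := hh.continuous.measurable
  have hmA : ∀ x, h x ∈ Set.Icc m A := fun x => ⟨hhm x, (le_abs_self _).trans (hA x)⟩
  have hS : Set.Icc m A ⊆ Set.Ioi 0 := fun t ht => hm.trans_le ht.1
  have h2 : deriv (deriv fun t : ℝ => t * log t) = fun t => t⁻¹ := funext deriv_deriv_mul_log
  have hloc : ∀ y, phiEnt (condDist G y) (fun t => t * log t) h ≤ β / 2 *
      ∫ x, deriv (deriv fun t => t * log t) (h x) * ‖gradient h x‖ ^ 2 ∂(condDist G y) :=
    fun y => hcond y h hh ⟨c, hc⟩ fun x => hS (hmA x)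
  have hFpos : ∀ y, 0 < ∫ x, h x ∂(condDist G y) := by
    intro y
    have hprob := isProbabilityMeasure_condDist hZ y
    have := integral_mono (integrable_const m)
      (Integrable.of_bound (μ := condDist G y) hhmeas.aestronglyMeasurable A
        (Eventually.of_forall hA)) hhm
    exact hm.trans_le (by simpa using this)
  have hent := fun u y => hMGF.entropy_nonneg_and_abs_integral_mul_le hG hZ hdiff hL hm hhmeas
    hmA u y
  have key := phiEnt_mixture_le (β := β) (L := L) (m := m) (M := A) hρ hG hZ hdiff hs hα hSI
    hS continuous_mul_log.continuousOn
    (by rw [h2]; exact continuousOn_inv₀.mono fun t ht => (hS ht).ne') hh hc hmA hloc (by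
      filter_upwards [ae_norm_fderiv_integral_condDist_le hG hZ hdiff hs hhmeas hA
        (b := fun y => L * √(2 * phiEnt (condDist G y) (fun t => t * log t) h *
          ∫ x, h x ∂(condDist G y)))
        (fun y => by positivity) (fun u => Eventually.of_forall fun y => (hent u y).2)] with y hy
      have h3 := pow_le_pow_left₀ (norm_nonneg _) hy 2
      have h5 := (hent 0 y).1
      have h6 := hFpos y
      rw [mul_pow, sq_sqrt (by positivity)] at h3
      have h4 := mul_le_mul_of_nonneg_left (hloc y) (sq_nonneg L)
      have h7 := mul_le_mul_of_nonneg_left h3 (inv_nonneg.2 h6.le)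
      have h8 : (∫ x, h x ∂(condDist G y))⁻¹ * (L ^ 2 *
          (2 * phiEnt (condDist G y) (fun t => t * log t) h * ∫ x, h x ∂(condDist G y))) =
          2 * (L ^ 2 * phiEnt (condDist G y) (fun t => t * log t) h) := by
        field_simp
      rw [deriv_deriv_mul_log]
      rw [h8] at h7
      linarith)
  simpa only [deriv_deriv_mul_log] using key

theorem logSobolev_mixture (hρ : ρ ≪ volume) (hG : Measurable (Function.uncurry G))
    (hZ : ∀ y, Integrable (fun x => exp (-G x y)) volume)
    (hdiff : ∀ x, Differentiable ℝ (fun y => log (condDensity G y x)))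
    (hα : 0 < α) (hβ : 0 < β) (hL : 0 < L)
    (hSI : PhiSI (Set.Ioi 0) (fun t => t * log t) α ρ)
    (hcond : ∀ y, PhiSI (Set.Ioi 0) (fun t => t * log t) β (condDist G y))
    (hMGF : MGFCriterion G L) : LSI (β + α * β * L ^ 2) (mixture ρ G) := by
  intro f hf hfc
  have hmix := isProbabilityMeasure_mixture hG hZ ρ
  have hc0 : HasCompactSupport fun x => f x - 0 := by simpa using hfc
  obtain ⟨A, hA⟩ := exists_bound_of_hasCompactSupport_sub hf.continuous hc0
  obtain ⟨A', hA'⟩ := exists_bound_fderiv_of_hasCompactSupport_sub hf hc0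
  have hgint : Integrable (fun x => ‖gradient f x‖ ^ 2) (mixture ρ G) := by
    refine Integrable.of_bound (measurable_norm_gradient_sq f).aestronglyMeasurable (A' ^ 2)
      (Eventually.of_forall fun x => ?_)
    rw [norm_pow, norm_norm, norm_gradient_eq_norm_fderiv]
    exact pow_le_pow_left₀ (norm_nonneg _) (hA' x) 2
  -- `f²` may vanish, so it is not an admissible test function; `f² + ε` is positive and constant
  -- outside a compact set.
  have hε : ∀ ε : ℝ, 0 < ε → phiEnt (mixture ρ G) (fun t => t * log t) (fun x => f x ^ 2 + ε) ≤
      2 * (β + α * β * L ^ 2) * ∫ x, ‖gradient f x‖ ^ 2 ∂(mixture ρ G) := by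
    intro ε hε
    have hsm : ContDiff ℝ ∞ fun x => f x ^ 2 + ε := (hf.pow 2).add contDiff_const
    have hcs : HasCompactSupport fun x => f x ^ 2 + ε - ε := by
      simp_rw [add_sub_cancel_right, sq]
      exact hfc.mul_right
    -- The left side is `4 f² ‖∇f‖² / (f² + ε)`; the factor `4` turns `ξ / 2` into `2 ξ`.
    have hgrad : ∀ x, (f x ^ 2 + ε)⁻¹ * ‖gradient (fun x => f x ^ 2 + ε) x‖ ^ 2 ≤
        4 * ‖gradient f x‖ ^ 2 := by
      intro x
      have hd : DifferentiableAt ℝ f x := hf.differentiable (by simp) x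
      have h1 : fderiv ℝ (fun x => f x ^ 2 + ε) x = (2 * f x) • fderiv ℝ f x := by
        rw [fderiv_add_const]
        simpa using (hd.hasFDerivAt.pow 2).fderiv
      have hpos : 0 < f x ^ 2 + ε := by positivity
      rw [norm_gradient_eq_norm_fderiv, norm_gradient_eq_norm_fderiv, h1, norm_smul, mul_pow,
        Real.norm_eq_abs, sq_abs, inv_mul_le_iff₀ hpos]
      nlinarith [mul_nonneg hε.le (sq_nonneg ‖fderiv ℝ f x‖)]
    have h1 := phiEnt_mul_log_mixture_le hρ hG hZ hdiff hα hL hSI hcond hMGF hsm hcs hε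
      fun x => le_add_of_nonneg_left (sq_nonneg _)
    have h2 := integral_mono_of_nonneg (μ := mixture ρ G)
      (Eventually.of_forall fun x => by
        simp only [Pi.zero_apply]
        positivity) (hgint.const_mul 4)
      (Eventually.of_forall hgrad)
    rw [integral_const_mul] at h2
    have hξ : 0 ≤ (β + α * β * L ^ 2) / 2 := by positivity
    have h3 := mul_le_mul_of_nonneg_left h2 hξ
    linarith
  have hlim0 := tendsto_one_div_add_atTop_nhds_zero_nat (𝕜 := ℝ)
  have hpos : ∀ n : ℕ, 0 < 1 / ((n : ℝ) + 1) := fun n => by positivity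
  have hle1 : ∀ n : ℕ, 1 / ((n : ℝ) + 1) ≤ 1 := fun n => by
    rw [div_le_one (by positivity)]
    linarith [Nat.cast_nonneg (α := ℝ) n]
  have hmem : ∀ (n : ℕ) (x : Euc d), f x ^ 2 + 1 / ((n : ℝ) + 1) ∈ Set.Icc 0 (A ^ 2 + 1) := by
    intro n x
    have h1 : f x ^ 2 ≤ A ^ 2 := by
      rw [← sq_abs]
      exact pow_le_pow_left₀ (abs_nonneg _) (hA x) 2
    exact ⟨add_nonneg (sq_nonneg _) (hpos n).le, add_le_add h1 (hle1 n)⟩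
  have hx : ∀ x, Tendsto (fun n : ℕ => f x ^ 2 + 1 / ((n : ℝ) + 1)) atTop (𝓝 (f x ^ 2)) :=
    fun x => by simpa using hlim0.const_add (f x ^ 2)
  have hconv : ∀ {Ψ : ℝ → ℝ}, Continuous Ψ →
      Tendsto (fun n : ℕ => ∫ x, Ψ (f x ^ 2 + 1 / ((n : ℝ) + 1)) ∂(mixture ρ G)) atTop
        (𝓝 (∫ x, Ψ (f x ^ 2) ∂(mixture ρ G))) := by
    intro Ψ hΨ
    obtain ⟨B, hB⟩ := isCompact_Icc.exists_bound_of_continuousOn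
      (hΨ.continuousOn (s := Set.Icc 0 (A ^ 2 + 1)))
    refine tendsto_integral_of_dominated_convergence (fun _ => B) (fun n => ?_)
      (integrable_const _) (fun n => Eventually.of_forall fun x => hB _ (hmem n x))
      (Eventually.of_forall fun x => (hΨ.tendsto _).comp (hx x))
    exact (hΨ.comp ((hf.continuous.pow 2).add continuous_const)).aestronglyMeasurable
  -- Since `t log t` is continuous at `0` with value `0`, the entropies converge as `ε = 1 / (n +
  -- 1)` tends to `0`.
  exact le_of_tendsto' ((hconv continuous_mul_log).sub
    ((continuous_mul_log.tendsto _).comp (hconv continuous_id))) fun n => hε _ (hpos n)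

end Mixture

end TwoScaleProof

theorem theorem2 {d : ℕ} (ρ : Measure (Euc d)) [IsProbabilityMeasure ρ]
    (hρ : ρ ≪ volume)
    (G : Euc d → Euc d → ℝ)
    (hG : Measurable (Function.uncurry G))
    (hZ : ∀ y, Integrable (fun x => exp (-G x y)) volume)
    (hdiff : ∀ x, Differentiable ℝ (fun y => log (condDensity G y x)))
    (α β L ξ : ℝ) (hα : 0 < α) (hβ : 0 < β) (hL : 0 < L)
    (hξ : ξ = β + α * β * L ^ 2) :
    (PhiSI Set.univ (fun t => t ^ 2) α ρ →
      (∀ y, PhiSI Set.univ (fun t => t ^ 2) β (condDist G y)) →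
      VarCriterion G L → PI ξ (mixture ρ G)) ∧
    (PhiSI (Set.Ioi 0) (fun t => t * log t) α ρ →
      (∀ y, PhiSI (Set.Ioi 0) (fun t => t * log t) β (condDist G y)) →
      MGFCriterion G L → LSI ξ (mixture ρ G)) ∧
    ξ < jointConst α β L := by
  subst hξ
  exact ⟨fun hSI hcond hVar => poincare_mixture hρ hG hZ hdiff hα hL hSI hcond hVar,
    fun hSI hcond hMGF => logSobolev_mixture hρ hG hZ hdiff hα hβ hL hSI hcond hMGF,
    lt_jointConst hα hβ hL⟩
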